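/- Let $M$ be a compact (connected) Riemann surface and $k$ a natural number. For $\mathcal I\subset\{1,\dots,k\}$ with $|\mathcal I|\ge 2$ let $\Delta_{\mathcal I}=\{\mathfrak p\in M^k : p_i=p_j \ \forall i,j\in\mathcal I\}$. Let $\mathcal E_k=[M^k;\bigcup_{\mathcal I}\Delta_{\mathcal I}]$ be the manifold with corners obtained from $M^k$ by successive real (oriented) blow-up of the lifts of all $\Delta_{\mathcal I}$, $|\mathcal I|\ge2$, in any order in which $\Delta_{\mathcal J}$ is blown up before $\Delta_{\mathcal I}$ whenever $\mathcal I\subsetneq\mathcal J$. Let $F_{\mathcal I}\subset\mathcal E_k$ be the boundary hypersurface created by blowing up $\Delta_{\mathcal I}$ (more precisely, its lift to $\mathcal E_k$), and let $F_{\max}=F_{\{1,\dots,k\}}$. The boundary faces and corners of $F_{\max}$ are the nonempty intersections of $F_{\max}$ with some (possibly no) other boundary hypersurfaces $F_{\mathcal I}$ of $\mathcal E_k$; thus $F_{\max}$ itself is included. Let $\mathcal G_k$ be the inclusion graph of the subsets of $\{1,\dots,k\}$. By a connected tree $T$ in $\mathcal G_k$ we mean a set of subsets of $\{1,\dots,k\}$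 (the vertices of $T$) that contains the root $\{1,\dots,k\}$ and is such that no nonempty set is contained in two vertices of $T$ neither of which contains the other; that is, any two vertices are nested or disjoint. (The edges of $T$ join each vertex other than the root to the smallest vertex of $T$ properly containing it.) Then $$Z\longmapsto T_Z=\{\mathcal I\subset\{1,\dots,k\} : |\mathcal I|\ge 2,\ Z\subset F_{\mathcal I}\}$$ is a bijection from the set of boundary faces and corners of $F_{\max}$ onto the set of connected trees in $\mathcal G_k$ all of whose minimal vertices have at least two elements. The inverse sends $T$ to $\bigcap_{\mathcal I\in T}F_{\mathcal I}$; in particular this intersection is nonempty for every such $T$. -/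

import Mathlib

open Set Topology Manifold
open scoped ContDiff

universe u

noncomputable section

/-! ### Spaces with smooth functions and their real blow-ups -/

/-- A topological space together with a set of real functions, its smooth functions.  A manifold
with corners is such a space, and its smooth structure is determined by its smooth functions. -/
structure SmoothSpace : Type (u + 1) where
  Carrier : Type u
  top : TopologicalSpace Carrier
  smooth : Set (Carrier → ℝ)

instance (X : SmoothSpace.{u}) : TopologicalSpace X.Carrier := X.top

namespace SmoothSpace

variable (X : SmoothSpace.{u}) (Y : Set X.Carrier)

/-- The ideal of the smooth functions on `X` that vanish on `Y`. -/
def ideal : Set (X.Carrier → ℝ) := {f | f ∈ X.smooth ∧ ∀ y ∈ Y, f y = 0}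

/-- Evaluation of the functions in the ideal of `Y` at a point `x`. -/
def evalAt (x : X.Carrier) : X.ideal Y → ℝ := fun f => f.1 x

/-- Nonzero real valued functions on the ideal of `Y`, up to positive scalars.  At a point of a
submanifold `Y`, a nonzero normal vector `v` gives such a ray, namely that of `f ↦ df(v)`. -/
abbrev Direction : Type u := Module.Ray ℝ (X.ideal Y → ℝ)

/-- The quotient topology of the topology of pointwise convergence. -/
instance : TopologicalSpace (X.Direction Y) :=
  TopologicalSpace.coinduced
    (fun v : {v : X.ideal Y → ℝ // v ≠ 0} => rayOfNeZero ℝ v.1 v.2) inferInstance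

/-- The points `x` outside `Y`, each paired with the ray of the evaluation at `x`. -/
def blowUpGraph : Set (X.Carrier × X.Direction Y) :=
  {q | ∃ h : X.evalAt Y q.1 ≠ 0, q.2 = rayOfNeZero ℝ (X.evalAt Y q.1) h}

/-- The points of the real (oriented) blow-up `[X; Y]`: the closure of the graph of the map that
sends `x ∉ Y` to the ray of the values at `x` of the functions vanishing on `Y`.
For a closed `p`-submanifold `Y` of a manifold with corners `X`, given near `y ∈ Y` by
`w₁ = ⋯ = w_m = 0` in adapted coordinates, `f = ∑ aᵢ wᵢ` for every `f` in the ideal of `Y`, so the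
points over `y` are the rays of `f ↦ ∑ aᵢ(y) ωᵢ`, with `ω` a limit of `w / |w|`: the fibre over
`y` is the (inward pointing) spherical normal bundle of `Y`, and over `X \ Y` nothing changes. -/
abbrev BlowUpCarrier : Type u := {q : X.Carrier × X.Direction Y // q ∈ closure (X.blowUpGraph Y)}

variable {X Y}

/-- `|g| = (g₁² + ⋯ + gₙ²)^(1/2)` as a function on `X`; when the `gⱼ` are local equations of `Y`,
this is the polar radius, a defining function of the front face. -/
def polarRadius {n : ℕ} (g : Fin n → X.ideal Y) (x : X.Carrier) : ℝ := √(∑ j, (g j).1 x ^ 2)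

/-- `|g|` evaluated on (some representative of) a direction. -/
def directionNorm {n : ℕ} (g : Fin n → X.ideal Y) (d : X.Direction Y) : ℝ :=
  √(∑ j, d.someVector (g j) ^ 2)

/-- The polar angle `g / |g|`, as a function on directions: independent of the representative, and
equal to `g(x) / |g(x)|` at the direction of a point `x ∉ Y`. -/
def polarAngle {n : ℕ} (g : Fin n → X.ideal Y) (d : X.Direction Y) : Fin n → ℝ :=
  fun j => d.someVector (g j) / directionNorm g d

variable (X Y)

/-- The real blow-up `[X; Y]`.  Its smooth functions are those that are, near each point, smooth
functions of the pullbacks of finitely many smooth functions `h` on `X` and of the polar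
coordinates `|g|`, `g / |g|`, where `g` is a finite tuple in the ideal of `Y` whose polar
coordinates are defined near that point. -/
def blowUp : SmoothSpace.{u} where
  Carrier := X.BlowUpCarrier Y
  top := inferInstance
  smooth := {φ | ∀ q₀ : X.BlowUpCarrier Y, ∃ U ∈ 𝓝 q₀, ∃ (m n : ℕ)
    (h : Fin m → X.Carrier → ℝ) (g : Fin n → X.ideal Y)
    (G : (Fin m → ℝ) × ℝ × (Fin n → ℝ) → ℝ),
    (∀ i, h i ∈ X.smooth) ∧ ContDiff ℝ ∞ G ∧
    ∀ q ∈ U, directionNorm g q.1.2 ≠ 0 ∧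
      φ q = G (fun i => h i q.1.1, polarRadius g q.1.1, polarAngle g q.1.2)}

/-- The blow-down map `[X; Y] → X`. -/
def blowDown : (X.blowUp Y).Carrier → X.Carrier := fun q => q.1.1

/-- The front face of `[X; Y]`. -/
def frontFace : Set (X.blowUp Y).Carrier := X.blowDown Y ⁻¹' Y

/-- The lift of `W ⊆ X` to `[X; Y]`: lift `W \ Y` and take the closure. -/
def lift (W : Set X.Carrier) : Set (X.blowUp Y).Carrier := closure (X.blowDown Y ⁻¹' (W \ Y))

end SmoothSpace

/-! ### The extended configuration space -/

/-- The manifold `M^k`, with its real `C^∞` functions, for a Riemann surface `M`. -/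
def configSpace (M : Type u) [TopologicalSpace M] [ChartedSpace ℂ M] (k : ℕ) :
    SmoothSpace.{u} where
  Carrier := Fin k → M
  top := inferInstance
  smooth := {f | ContMDiff (ModelWithCorners.pi (fun _ : Fin k => 𝓘(ℝ, ℂ))) 𝓘(ℝ, ℝ) ∞ f}

/-- The partial diagonal `Δ_I` in `M^k`. -/
def partialDiagonal (M : Type u) (k : ℕ) (I : Finset (Fin k)) : Set (Fin k → M) :=
  {p | ∀ i ∈ I, ∀ j ∈ I, p i = p j}

/-- A stage of the iterated blow-up of the partial diagonals. -/
structure BlowUpStage (k : ℕ) : Type (u + 1) where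
  /-- The space obtained so far. -/
  space : SmoothSpace.{u}
  /-- The lift to it of each partial diagonal that has not been blown up. -/
  diagonal : Finset (Fin k) → Set space.Carrier
  /-- The lift to it of the front face created by blowing up `Δ_I`; empty if `Δ_I` has not been
  blown up. -/
  face : Finset (Fin k) → Set space.Carrier

namespace BlowUpStage

/-- The initial stage, `M^k`. -/
def initial (M : Type u) [TopologicalSpace M] [ChartedSpace ℂ M] (k : ℕ) :
    BlowUpStage.{u} k where
  space := configSpace M k
  diagonal := partialDiagonal M k
  face := fun _ => ∅

variable {k : ℕ}

/-- The next stage: blow up the lift of `Δ_I`. -/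
def step (S : BlowUpStage.{u} k) (I : Finset (Fin k)) : BlowUpStage.{u} k where
  space := S.space.blowUp (S.diagonal I)
  diagonal := fun J => S.space.lift (S.diagonal I) (S.diagonal J)
  face := fun J => if J = I then S.space.frontFace (S.diagonal I)
    else S.space.lift (S.diagonal I) (S.face J)

end BlowUpStage

/-- An admissible order of blow-up: the list runs once through all index sets with at least two
elements, and `J` comes before `I` whenever `I ⊊ J`. -/
def IsBlowUpOrder {k : ℕ} (L : List (Finset (Fin k))) : Prop :=
  L.Nodup ∧ (∀ I, I ∈ L ↔ 2 ≤ I.card) ∧ L.Pairwise (fun I J => ¬ I ⊂ J)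

/-- The extended configuration space `ℰ_k = [M^k; ⋃ Δ_I]`, with its faces `F_I`, for the given
order of blow-up. -/
def extendedConfig (M : Type u) [TopologicalSpace M] [ChartedSpace ℂ M] (k : ℕ)
    (L : List (Finset (Fin k))) : BlowUpStage.{u} k :=
  L.foldl BlowUpStage.step (BlowUpStage.initial M k)

namespace BlowUpStage

variable {k : ℕ} (E : BlowUpStage.{u} k)

/-- The boundary faces and corners of `F_max`, the face of the full index set: the nonempty
intersections of `F_max` with boundary hypersurfaces `F_I` (including `F_max` itself). -/
def IsCornerOfMax (Z : Set E.space.Carrier) : Prop :=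
  Z.Nonempty ∧ ∃ S : Set (Finset (Fin k)), (∀ I ∈ S, 2 ≤ I.card) ∧
    Z = E.face Finset.univ ∩ ⋂ I ∈ S, E.face I

/-- The vertex set of the tree `T_Z`: the index sets whose face contains `Z`. -/
def tree (Z : Set E.space.Carrier) : Set (Finset (Fin k)) := {I | 2 ≤ I.card ∧ Z ⊆ E.face I}

end BlowUpStage

/-- `T` is the vertex set of a connected tree in the inclusion graph of the subsets of
`{1, …, k}`, with minimal vertices of size at least `2`.  It emanates from the root `{1, …, k}`,
and its branches do not meet again: no nonempty subset `K` lies below two vertices of which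
neither contains the other. -/
structure IsClusterTree {k : ℕ} (T : Set (Finset (Fin k))) : Prop where
  root : Finset.univ ∈ T
  branch : ∀ I ∈ T, ∀ J ∈ T, ∀ K : Finset (Fin k), K.Nonempty → K ⊆ I → K ⊆ J → I ⊆ J ∨ J ⊆ I
  two_le_card : ∀ I, Minimal (· ∈ T) I → 2 ≤ I.card

end

/-!
The iterated blow-up is analysed entirely in local coordinates, and every stage is shown to be
linear near each of its points, in one fixed Euclidean space, the space `ConfigVec k` of vectors in
`ℂ^k`.  Near a point `z` of a stage there are coordinates centred at `z`
(`BlowUpStage.IsLocalModel`) in which the diagonals `Δ_J` through `z` that are still to be blown up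
are the subspaces `diagSubspace J` of the vectors whose entries with index in `J` coincide, and the
faces `F_K` through `z` are the hyperplanes orthogonal to unit vectors `e K`, where `e K` is
orthogonal to `diagSubspace K` and lies in `diagSubspace J` for each remaining `Δ_J`.

A single blow-up of a subspace, with normal space `N`, is described by projective coordinates.  By
Hadamard's lemma (`exists_contDiff_eq_apply_starProjection`) the ideal of the subspace is generated
by the coordinates along `N`, so a ray in the definition of the blow-up over a point `x` amounts to
a unit vector `θ` in `N`, its polar vector, which is compatible with the position of `x`
(`SmoothSpace.IsAdaptedChart.someVector_apply`, `SmoothSpace.IsAdaptedChart.exists_blowUp_point`).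
Near a point with polar vector `e`, the blow-up is the part `0 ≤ ⟨c, e⟩` of the domain of the
coordinates `c`, with blow-down map `polarBlowDown`
(`SmoothSpace.IsAdaptedChart.isChart_blowUpCoord`).  Off the front face, a subspace that contains
`N`, or that contains both `Nᗮ` and `e`, is its own preimage under this map, which identifies the
lifts of the other diagonals and faces.

Let now `Δ_I` be the next diagonal through `z` in an admissible order.  Any other remaining `Δ_J`
through `z` has `J ⊂ I` or `J` disjoint from `I`, since otherwise `I ∪ J` would have to be blown up
earlier.  Over `z`, the polar vector `v ∈ (diagSubspace I)ᗮ` becomes the normal vector `e I` of the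
new face, and exactly those diagonals survive for which `v ∈ diagSubspace J`
(`BlowUpStage.IsLocalModel.step_of_mem`).  Hence the index sets of the faces through a point of
`ℰ_k` are pairwise nested or disjoint (`BlowUpStage.nested_of_mem_face`), and `T_Z` is always a
tree.

Conversely, for a tree `T` choose for each vertex `K` a unit vector `e K` orthogonal to
`diagSubspace K` for which the entries with index in `J ⊆ K`, where `2 ≤ |J|`, coincide precisely
when `J` is contained in a smaller vertex (`IsClusterTree.exists_normal`).  Start from a point of
the small diagonal of `M^k`, and in the blow-up of `Δ_K`, for `K ∈ T`, move to the point over it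
with polar vector `e K`.  The diagonals of the vertices of `T` survive until it is their turn, and
each other `Δ_I` disappears when the smallest vertex containing `I` is blown up, so the final point
lies on precisely the faces `F_K` with `K ∈ T` (`BlowUpStage.exists_mem_face_iff`).  Since a corner
is the intersection of the faces that contain it, these two facts give the bijection.
-/

open Filter

/-! ### Smooth functions on a Euclidean space -/

section Analysis

/-- A family of smooth functions on a Euclidean space that depends smoothly on a parameter in
`[0, 1]` can be integrated over the parameter. -/
theorem contDiff_intervalIntegral_param {E F : Type} [NormedAddCommGroup E] [NormedSpace ℝ E]
    [FiniteDimensional ℝ E] [NormedAddCommGroup F] [NormedSpace ℝ F] [FiniteDimensional ℝ F]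
    {φ : E × ℝ → F} (hφ : ContDiff ℝ ∞ φ) :
    ContDiff ℝ ∞ (fun x : E => ∫ s in (0 : ℝ)..1, φ (x, s)) := by
  have key : ∀ {F : Type} [NormedAddCommGroup F] [NormedSpace ℝ F] [FiniteDimensional ℝ F]
      {φ : E × ℝ → F}, ContDiff ℝ ∞ φ → ∀ x : E,
      HasFDerivAt (fun x : E => ∫ s in (0 : ℝ)..1, φ (x, s))
        (∫ s in (0 : ℝ)..1, (fderiv ℝ φ (x, s)).comp (ContinuousLinearMap.inl ℝ E ℝ)) x := by
    intro F _ _ _ φ hφ x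
    have hF' : Continuous fun p : E × ℝ =>
        (fderiv ℝ φ p).comp (ContinuousLinearMap.inl ℝ E ℝ) :=
      (hφ.continuous_fderiv (by simp)).clm_comp continuous_const
    obtain ⟨K, hK⟩ := ((isCompact_closedBall x 1).prod (isCompact_Icc (a := (0 : ℝ)) (b := 1))
      ).exists_bound_of_continuousOn hF'.continuousOn
    refine intervalIntegral.hasFDerivAt_integral_of_dominated_of_fderiv_le
      (F' := fun y s => (fderiv ℝ φ (y, s)).comp (ContinuousLinearMap.inl ℝ E ℝ))
      (bound := fun _ => K)
      (Metric.closedBall_mem_nhds x one_pos) ?_ ?_ ?_ ?_ ?_ ?_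
    · exact .of_forall fun y => (hφ.continuous.comp (by fun_prop)).aestronglyMeasurable
    · exact (hφ.continuous.comp (by fun_prop)).intervalIntegrable _ _
    · exact (hF'.comp (by fun_prop : Continuous fun s : ℝ => (x, s))).aestronglyMeasurable
    · refine .of_forall fun s hs y hy => hK (y, s) ⟨hy, ?_⟩
      rw [uIoc_of_le zero_le_one] at hs
      exact Ioc_subset_Icc_self hs
    · exact intervalIntegrable_const
    · refine .of_forall fun s _ y _ => ?_
      have h1 : HasFDerivAt φ (fderiv ℝ φ (y, s)) (y, s) :=
        (hφ.differentiable (by simp) _).hasFDerivAt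
      have h2 : HasFDerivAt (fun y : E => (y, s)) (ContinuousLinearMap.inl ℝ E ℝ) y :=
        hasFDerivAt_prodMk_left y s
      exact h1.comp y h2
  -- the target varies in the induction, because the derivative is operator-valued
  have main : ∀ n : ℕ, ∀ {F : Type} [NormedAddCommGroup F] [NormedSpace ℝ F]
      [FiniteDimensional ℝ F] {φ : E × ℝ → F}, ContDiff ℝ ∞ φ →
      ContDiff ℝ n (fun x : E => ∫ s in (0 : ℝ)..1, φ (x, s)) := by
    intro n
    induction n with
    | zero =>
      intro F _ _ _ φ hφ
      exact contDiff_zero.2 <| continuous_iff_continuousAt.2 fun x => (key hφ x).continuousAt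
    | succ n ih =>
      intro F _ _ _ φ hφ
      have hd : fderiv ℝ (fun x : E => ∫ s in (0 : ℝ)..1, φ (x, s)) = fun x =>
          ∫ s in (0 : ℝ)..1, (fderiv ℝ φ (x, s)).comp (ContinuousLinearMap.inl ℝ E ℝ) :=
        funext fun x => (key hφ x).fderiv
      rw [Nat.cast_succ, contDiff_succ_iff_fderiv]
      refine ⟨fun x => (key hφ x).differentiableAt, by simp, ?_⟩
      rw [hd]
      exact ih (φ := fun p => (fderiv ℝ φ p).comp (ContinuousLinearMap.inl ℝ E ℝ))
        ((hφ.fderiv_right (by simp)).clm_comp contDiff_const)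
  exact contDiff_infty.2 fun n => main n hφ

variable {E : Type} [NormedAddCommGroup E] [InnerProductSpace ℝ E] [FiniteDimensional ℝ E]

/-- Smooth functions on an open set extend from a neighbourhood of a point to all of the space. -/
theorem ContDiffOn.exists_contDiff_eventuallyEq {V F : Type} [NormedAddCommGroup V]
    [NormedSpace ℝ V] [HasContDiffBump V] [NormedAddCommGroup F] [NormedSpace ℝ F] {f : V → F}
    {U : Set V} [FiniteDimensional ℝ V]
    (hf : ContDiffOn ℝ ∞ f U) (hU : IsOpen U) {x : V} (hx : x ∈ U) :
    ∃ g : V → F, ContDiff ℝ ∞ g ∧ g =ᶠ[𝓝 x] f := by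
  obtain ⟨ε, hε, hεU⟩ := Metric.isOpen_iff.1 hU x hx
  let χ : ContDiffBump x := ⟨ε / 4, ε / 2, by positivity, by linarith⟩
  refine ⟨fun y => χ y • f y, contDiff_iff_contDiffAt.2 fun y => ?_, ?_⟩
  · by_cases hy : y ∈ U
    · exact χ.contDiffAt.smul (hf.contDiffAt (hU.mem_nhds hy))
    · have hy' : y ∉ tsupport χ := by
        rw [χ.tsupport_eq]
        intro h
        exact hy (hεU (Metric.closedBall_subset_ball (by show ε / 2 < ε; linarith) h))
      refine contDiffAt_const (c := (0 : F)) |>.congr_of_eventuallyEq ?_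
      filter_upwards [notMem_tsupport_iff_eventuallyEq.1 hy'] with w hw
      simp [hw]
  · filter_upwards [χ.eventuallyEq_one] with y hy
    simp [hy]

/-- Hadamard's lemma: if `G` vanishes on the part of `C` orthogonal to `N`, near the point `c₀`,
then on `C` near `c₀` it is a smooth combination of the coordinates along `N`. -/
theorem exists_contDiff_eq_apply_starProjection {N : Submodule ℝ E} {C : Set E}
    (hC : ∀ c ∈ C, ∀ n ∈ N, c + n ∈ C) {G : E → ℝ} (hG : ContDiff ℝ ∞ G) {c₀ : E}
    (h0 : ∀ᶠ c in 𝓝 c₀, c ∈ C → c ∈ Nᗮ → G c = 0) :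
    ∃ a : E → (E →L[ℝ] ℝ), ContDiff ℝ ∞ a ∧
      ∀ᶠ c in 𝓝 c₀, c ∈ C → G c = a c (N.starProjection c) := by
  set π := N.starProjection with hπ
  by_cases hc₀ : c₀ ∈ Nᗮ
  -- integrate the derivative along the segment from `c - π c`, where `G` vanishes, to `c`
  · refine ⟨fun c => ∫ s in (0 : ℝ)..1, fderiv ℝ G (c - π c + s • π c), ?_, ?_⟩
    · exact contDiff_intervalIntegral_param (φ := fun p : E × ℝ =>
        fderiv ℝ G (p.1 - π p.1 + p.2 • π p.1))
        ((hG.fderiv_right (m := ∞) (by simp)).comp (by fun_prop))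
    · have hcont : Tendsto (fun c => c - π c) (𝓝 c₀) (𝓝 c₀) := by
        have h1 : Continuous fun c => c - π c := by fun_prop
        have h2 : π c₀ = 0 := by
          rw [hπ, Submodule.starProjection_apply_eq_zero_iff]; exact hc₀
        simpa [h2] using h1.tendsto c₀
      filter_upwards [hcont.eventually h0] with c hc hcC
      have hC' : c - π c ∈ C := by
        rw [sub_eq_add_neg]
        exact hC c hcC _ (N.neg_mem (N.starProjection_apply_mem c))
      have hz : G (c - π c) = 0 := hc hC' (N.sub_starProjection_mem_orthogonal c)
      have hderiv : ∀ s : ℝ, HasDerivAt (fun s : ℝ => G (c - π c + s • π c))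
          (fderiv ℝ G (c - π c + s • π c) (π c)) s := by
        intro s
        have h1 : HasFDerivAt G (fderiv ℝ G (c - π c + s • π c)) (c - π c + s • π c) :=
          (hG.differentiable (by simp) _).hasFDerivAt
        have h2 : HasDerivAt (fun s : ℝ => c - π c + s • π c) (π c) s := by
          simpa using ((hasDerivAt_id s).smul_const (π c)).const_add (c - π c)
        exact h1.comp_hasDerivAt s h2
      have hcd : Continuous fun s : ℝ => fderiv ℝ G (c - π c + s • π c) :=
        (hG.continuous_fderiv (by simp)).comp (by fun_prop)
      have h3 := intervalIntegral.integral_eq_sub_of_hasDerivAt (a := 0) (b := 1)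
        (fun s _ => hderiv s) ((hcd.clm_apply continuous_const).intervalIntegrable _ _)
      rw [ContinuousLinearMap.intervalIntegral_apply (hcd.intervalIntegrable _ _), h3]
      simp [hz]
  -- away from the subspace, `π c` vanishes nowhere and one may divide by its norm
  · have hopen : IsOpen {c : E | π c ≠ 0} :=
      isOpen_ne_fun π.continuous continuous_const
    have hmem : π c₀ ≠ 0 := by
      rw [hπ, Ne, Submodule.starProjection_apply_eq_zero_iff]; exact hc₀
    have hsm : ContDiffOn ℝ ∞ (fun c : E => (G c / ‖π c‖ ^ 2) • innerSL ℝ (π c))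
        {c : E | π c ≠ 0} := by
      have h1 : ContDiffOn ℝ ∞ (fun c : E => G c / ‖π c‖ ^ 2) {c : E | π c ≠ 0} :=
        hG.contDiffOn.div (π.contDiff.norm_sq ℝ).contDiffOn fun c hc =>
          pow_ne_zero 2 (norm_ne_zero_iff.2 hc)
      have h2 : ContDiff ℝ ∞ (fun c : E => innerSL ℝ (π c)) :=
        ContinuousLinearMap.contDiff (innerSL ℝ ∘L π)
      exact h1.smul h2.contDiffOn
    obtain ⟨a, ha, hae⟩ := hsm.exists_contDiff_eventuallyEq hopen hmem
    refine ⟨a, ha, ?_⟩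
    filter_upwards [hae, hopen.mem_nhds hmem] with c hc hc' _
    have : ‖π c‖ ≠ 0 := norm_ne_zero_iff.2 hc'
    rw [hc]
    simp only [smul_apply, innerSL_apply_apply, real_inner_self_eq_norm_sq,
      smul_eq_mul]
    field_simp

end Analysis

/-! ### Rays of functions -/

namespace SmoothSpace

variable (X : SmoothSpace.{u}) (Y : Set X.Carrier)

/-- The ray of a nonzero function on the ideal of `Y`. -/
def rayMk (v : {v : X.ideal Y → ℝ // v ≠ 0}) : X.Direction Y := rayOfNeZero ℝ v.1 v.2

theorem rayMk_eq_iff {v w : {v : X.ideal Y → ℝ // v ≠ 0}} :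
    X.rayMk Y v = X.rayMk Y w ↔ ∃ r : ℝ, 0 < r ∧ r • v.1 = w.1 := by
  rw [rayMk, rayMk, ray_eq_iff, exists_pos_left_iff_sameRay v.2 w.2]

theorem isOpenQuotientMap_rayMk : IsOpenQuotientMap (X.rayMk Y) where
  surjective := Module.Ray.ind ℝ fun v hv => ⟨⟨v, hv⟩, rfl⟩
  continuous := continuous_coinduced_rng
  isOpenMap := by
    intro U hU
    rw [isOpen_coinduced]
    have : (fun v : {v : X.ideal Y → ℝ // v ≠ 0} => rayOfNeZero ℝ v.1 v.2) ⁻¹' (X.rayMk Y '' U) =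
        ⋃ r : {r : ℝ // 0 < r}, (fun v : {v : X.ideal Y → ℝ // v ≠ 0} =>
          (⟨r.1 • v.1, smul_ne_zero r.2.ne' v.2⟩ : {v : X.ideal Y → ℝ // v ≠ 0})) ⁻¹' U := by
      ext v
      simp only [mem_preimage, mem_image, mem_iUnion]
      constructor
      · rintro ⟨w, hw, h⟩
        obtain ⟨r, hr, h'⟩ := (X.rayMk_eq_iff Y (v := v)).1 h.symm
        exact ⟨⟨r, hr⟩, by simpa [h'] using hw⟩
      · rintro ⟨r, hr⟩
        exact ⟨_, hr, ((X.rayMk_eq_iff Y).2 ⟨r.1, r.2, rfl⟩).symm⟩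
    rw [this]
    exact isOpen_iUnion fun r => hU.preimage (by fun_prop)

instance : T2Space (X.Direction Y) := by
  rw [t2Space_iff_of_isOpenQuotientMap (X.isOpenQuotientMap_rayMk Y)]
  -- for nonzero functions, lying on the same ray is a closed condition on the values
  have : {q : {v : X.ideal Y → ℝ // v ≠ 0} × {v : X.ideal Y → ℝ // v ≠ 0} |
      X.rayMk Y q.1 = X.rayMk Y q.2} =
      ⋂ f, ⋂ f', {q | q.1.1 f * q.2.1 f' = q.1.1 f' * q.2.1 f ∧ 0 ≤ q.1.1 f * q.2.1 f} := by
    ext ⟨⟨v, hv⟩, ⟨w, hw⟩⟩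
    simp only [mem_ofPred_eq, rayMk_eq_iff, mem_iInter]
    constructor
    · rintro ⟨r, hr, rfl⟩ f f'
      simp only [Pi.smul_apply, smul_eq_mul]
      exact ⟨by ring, by nlinarith [mul_self_nonneg (v f)]⟩
    · intro h
      obtain ⟨f₀, hf₀⟩ := Function.ne_iff.1 hv
      simp only [Pi.zero_apply] at hf₀
      have hwv : ∀ f, w f = w f₀ / v f₀ * v f := fun f => by
        have := (h f₀ f).1
        field_simp
        linarith
      have hne : w f₀ ≠ 0 := fun h0 => hw (funext fun f => by simp [hwv f, h0])
      refine ⟨w f₀ / v f₀, ?_, funext fun f => (hwv f).symm⟩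
      have h1 : 0 < v f₀ * w f₀ := lt_of_le_of_ne (h f₀ f₀).2 (mul_ne_zero hf₀ hne).symm
      have h2 : w f₀ / v f₀ = v f₀ * w f₀ / v f₀ ^ 2 := by field_simp
      rw [h2]
      positivity
  rw [this]
  refine isClosed_iInter fun f => isClosed_iInter fun f' => ?_
  have hc : ∀ f, Continuous fun v : {v : X.ideal Y → ℝ // v ≠ 0} => v.1 f := fun f =>
    (continuous_apply f).comp continuous_subtype_val
  rw [Set.ofPred_and]
  refine IsClosed.inter (isClosed_eq ?_ ?_) (isClosed_le continuous_const ?_)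
  · exact ((hc f).comp continuous_fst).mul ((hc f').comp continuous_snd)
  · exact ((hc f').comp continuous_fst).mul ((hc f).comp continuous_snd)
  · exact ((hc f).comp continuous_fst).mul ((hc f).comp continuous_snd)

variable {X Y}

theorem rayMk_someVector (d : X.Direction Y) : X.rayMk Y ⟨d.someVector, d.someVector_ne_zero⟩ = d :=
  d.someVector_ray

/-- A representative of the ray of `v` is a positive multiple of `v`. -/
theorem exists_someVector_rayMk (v : {v : X.ideal Y → ℝ // v ≠ 0}) :
    ∃ r : ℝ, 0 < r ∧ (X.rayMk Y v).someVector = r • v.1 := by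
  have h := rayMk_someVector (X.rayMk Y v)
  obtain ⟨r, hr, h'⟩ := (X.rayMk_eq_iff Y).1 h.symm
  exact ⟨r, hr, h'.symm⟩

/-- Rays converge if suitable representatives converge pointwise. -/
theorem tendsto_direction {α : Type*} {F : Filter α} {d : α → X.Direction Y}
    {v : {v : X.ideal Y → ℝ // v ≠ 0}} (w : α → X.ideal Y → ℝ)
    (hw : ∀ᶠ a in F, ∃ h : w a ≠ 0, d a = X.rayMk Y ⟨w a, h⟩)
    (hv : ∀ f, Tendsto (fun a => w a f) F (𝓝 (v.1 f))) :
    Tendsto d F (𝓝 (X.rayMk Y v)) := by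
  classical
  let w' : α → {v : X.ideal Y → ℝ // v ≠ 0} := fun a => if h : w a ≠ 0 then ⟨w a, h⟩ else v
  have hw' : Tendsto w' F (𝓝 v) := by
    rw [tendsto_subtype_rng, tendsto_pi_nhds]
    intro f
    refine (hv f).congr' ?_
    filter_upwards [hw] with a ⟨ha, _⟩
    simp [w', ha]
  refine (((X.isOpenQuotientMap_rayMk Y).continuous.tendsto v).comp hw').congr' ?_
  filter_upwards [hw] with a ⟨ha, h⟩
  simp [w', ha, h]

/-- A ray `v` over the point `x` belongs to the blow-up if and only if `(x, v)` is a limit of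
positive multiples of evaluations. -/
theorem mem_closure_blowUpGraph_iff {x : X.Carrier} {v : {v : X.ideal Y → ℝ // v ≠ 0}} :
    (x, X.rayMk Y v) ∈ closure (X.blowUpGraph Y) ↔
      ∃ F : Filter (X.Carrier × ℝ), F.NeBot ∧ (∀ᶠ p in F, 0 < p.2 ∧ X.evalAt Y p.1 ≠ 0) ∧
        Tendsto Prod.fst F (𝓝 x) ∧ ∀ f, Tendsto (fun p => p.2 * f.1 p.1) F (𝓝 (v.1 f)) := by
  constructor
  · intro h
    have hP := (IsOpenQuotientMap.id (X := X.Carrier)).prodMap (X.isOpenQuotientMap_rayMk Y)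
    have h1 : (x, v) ∈ closure (Prod.map id (X.rayMk Y) ⁻¹' X.blowUpGraph Y) := by
      rw [← hP.isOpenMap.preimage_closure_eq_closure_preimage hP.continuous]
      exact h
    let S : Set (X.Carrier × ℝ) := {p | 0 < p.2 ∧ X.evalAt Y p.1 ≠ 0}
    let j : X.Carrier × ℝ → X.Carrier × (X.ideal Y → ℝ) := fun p => (p.1, p.2 • X.evalAt Y p.1)
    have h2 : (x, v.1) ∈ closure (j '' S) := by
      refine map_mem_closure (f := Prod.map id Subtype.val) (by fun_prop) h1 ?_
      rintro ⟨y, w⟩ ⟨hy, hyw⟩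
      obtain ⟨r, hr, h'⟩ := (X.rayMk_eq_iff Y (v := ⟨_, hy⟩) (w := w)).1 hyw.symm
      exact ⟨(y, r), ⟨hr, hy⟩, congrArg (Prod.mk y) h'⟩
    have h3 : (comap j (𝓝 (x, v.1)) ⊓ 𝓟 S).NeBot := by
      rw [mem_closure_iff_clusterPt, ClusterPt, ← map_principal] at h2
      rw [← map_neBot_iff j, Filter.push_pull']
      exact h2
    refine ⟨_, h3, mem_inf_of_right (mem_principal_self S), ?_, fun f => ?_⟩
    · have : Tendsto j (comap j (𝓝 (x, v.1)) ⊓ 𝓟 S) (𝓝 (x, v.1)) :=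
        tendsto_comap.mono_left inf_le_left
      exact (continuous_fst.tendsto _).comp this
    · have : Tendsto j (comap j (𝓝 (x, v.1)) ⊓ 𝓟 S) (𝓝 (x, v.1)) :=
        tendsto_comap.mono_left inf_le_left
      exact (((continuous_apply f).comp continuous_snd).tendsto _).comp this
  · rintro ⟨F, hF, hpos, hx, hv⟩
    classical
    refine mem_closure_of_tendsto (b := F) (f := fun p => (p.1, if h : X.evalAt Y p.1 ≠ 0 then
      X.rayMk Y ⟨_, h⟩ else X.rayMk Y v)) ?_ ?_
    · refine hx.prodMk_nhds (tendsto_direction (fun p => p.2 • X.evalAt Y p.1) ?_ hv)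
      filter_upwards [hpos] with p ⟨h1, h2⟩
      refine ⟨smul_ne_zero h1.ne' h2, ?_⟩
      rw [dif_pos h2, rayMk_eq_iff]
      exact ⟨_, h1, rfl⟩
    · filter_upwards [hpos] with p ⟨_, h2⟩
      exact ⟨h2, by simp only [dif_pos h2]; rfl⟩

instance [T2Space X.Carrier] : T2Space (X.blowUp Y).Carrier :=
  inferInstanceAs (T2Space (X.BlowUpCarrier Y))

/-- The point of the blow-up over a point at which some function of the ideal does not vanish. -/
def graphPoint {x : X.Carrier} (h : X.evalAt Y x ≠ 0) : (X.blowUp Y).Carrier :=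
  ⟨(x, X.rayMk Y ⟨_, h⟩), subset_closure ⟨h, rfl⟩⟩

theorem continuous_blowDown : Continuous (X.blowDown Y) :=
  continuous_fst.comp continuous_subtype_val

/-- Whether the polar coordinates of `g` are defined at a ray can be read off from any vector on
that ray. -/
theorem directionNorm_rayMk_ne_zero_iff {n : ℕ} (g : Fin n → X.ideal Y)
    (v : {v : X.ideal Y → ℝ // v ≠ 0}) :
    directionNorm g (X.rayMk Y v) ≠ 0 ↔ ∑ j, v.1 (g j) ^ 2 ≠ 0 := by
  obtain ⟨r, hr, h⟩ := exists_someVector_rayMk v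
  have : ∑ j, (X.rayMk Y v).someVector (g j) ^ 2 = r ^ 2 * ∑ j, v.1 (g j) ^ 2 := by
    rw [h, Finset.mul_sum]
    exact Finset.sum_congr rfl fun j _ => by simp [mul_pow]
  rw [directionNorm, this, Ne, Real.sqrt_eq_zero (by positivity)]
  simp [hr.ne']

theorem polarAngle_rayMk {n : ℕ} (g : Fin n → X.ideal Y) (v : {v : X.ideal Y → ℝ // v ≠ 0})
    (j : Fin n) :
    polarAngle g (X.rayMk Y v) j = v.1 (g j) / √(∑ j, v.1 (g j) ^ 2) := by
  obtain ⟨r, hr, h⟩ := exists_someVector_rayMk v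
  have : ∑ j, (X.rayMk Y v).someVector (g j) ^ 2 = r ^ 2 * ∑ j, v.1 (g j) ^ 2 := by
    rw [h, Finset.mul_sum]
    exact Finset.sum_congr rfl fun j _ => by simp [mul_pow]
  rw [polarAngle, directionNorm, this, Real.sqrt_mul (by positivity), Real.sqrt_sq hr.le, h,
    Pi.smul_apply, smul_eq_mul, mul_div_mul_left _ _ hr.ne']

theorem isOpen_directionNorm_ne_zero {n : ℕ} (g : Fin n → X.ideal Y) :
    IsOpen {d : X.Direction Y | directionNorm g d ≠ 0} := by
  rw [← (X.isOpenQuotientMap_rayMk Y).isQuotientMap.isOpen_preimage]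
  have hc : ∀ f, Continuous fun v : {v : X.ideal Y → ℝ // v ≠ 0} => v.1 f := fun f =>
    (continuous_apply f).comp continuous_subtype_val
  simp only [preimage_ofPred_eq, directionNorm_rayMk_ne_zero_iff]
  exact isOpen_ne_fun (continuous_finsetSum _ fun j _ => (hc _).pow 2) continuous_const

theorem continuousAt_polarAngle {n : ℕ} {g : Fin n → X.ideal Y} {d : X.Direction Y}
    (hd : directionNorm g d ≠ 0) : ContinuousAt (polarAngle g) d := by
  obtain ⟨v, rfl⟩ := (X.isOpenQuotientMap_rayMk Y).surjective d
  rw [← (X.isOpenQuotientMap_rayMk Y).continuousAt_comp_iff, continuousAt_pi]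
  have hc : ∀ f, Continuous fun v : {v : X.ideal Y → ℝ // v ≠ 0} => v.1 f := fun f =>
    (continuous_apply f).comp continuous_subtype_val
  intro j
  simp only [Function.comp_def, polarAngle_rayMk]
  refine (hc _).continuousAt.div
    (continuous_finsetSum _ fun j _ => (hc _).pow 2).sqrt.continuousAt ?_
  rw [directionNorm_rayMk_ne_zero_iff] at hd
  exact (Real.sqrt_ne_zero (by positivity)).2 hd

end SmoothSpace

/-! ### Charts with values in a subset of a Euclidean space -/

namespace SmoothSpace

variable {E : Type} [NormedAddCommGroup E] [InnerProductSpace ℝ E]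

/-- `Φ` restricts to a homeomorphism of the open set `O` onto a relatively open subset of the closed
set `C`, in which the germs of smooth functions are those of smooth functions on `E`.  The values
of `Φ` outside `O` are irrelevant. -/
structure IsChart (X : SmoothSpace.{u}) (C : Set E) (O : Set X.Carrier) (Φ : X.Carrier → E) :
    Prop where
  isClosed : IsClosed C
  isOpen : IsOpen O
  nhds_eq : ∀ x ∈ O, 𝓝 x = comap Φ (𝓝 (Φ x)) ⊓ 𝓟 O
  mapsTo : MapsTo Φ O C
  image_mem : ∀ x ∈ O, Φ '' O ∈ 𝓝[C] (Φ x)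
  smooth_iff : ∀ x ∈ O, ∀ f : X.Carrier → ℝ, (∃ f' ∈ X.smooth, f' =ᶠ[𝓝 x] f) ↔
    ∃ G : E → ℝ, ContDiff ℝ ∞ G ∧ f =ᶠ[𝓝 x] G ∘ Φ

/-- A Hausdorff space whose smooth functions are characterized locally, and which is locally
isomorphic to closed subsets of `E`. -/
structure HasCharts (E : Type) [NormedAddCommGroup E] [InnerProductSpace ℝ E]
    (X : SmoothSpace.{u}) : Prop where
  t2 : T2Space X.Carrier
  smooth_of_locally : ∀ f : X.Carrier → ℝ, (∀ x, ∃ f' ∈ X.smooth, f' =ᶠ[𝓝 x] f) → f ∈ X.smooth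
  exists_isChart : ∀ x : X.Carrier, ∃ (C : Set E) (O : Set X.Carrier) (Φ : X.Carrier → E),
    x ∈ O ∧ X.IsChart C O Φ

variable {X : SmoothSpace.{u}} {C : Set E} {O : Set X.Carrier} {Φ : X.Carrier → E}

namespace IsChart

variable {x : X.Carrier}

theorem mem_nhds (h : X.IsChart C O Φ) (hx : x ∈ O) : O ∈ 𝓝 x := h.isOpen.mem_nhds hx

theorem continuousAt (h : X.IsChart C O Φ) (hx : x ∈ O) : ContinuousAt Φ x := by
  rw [ContinuousAt, tendsto_iff_comap, h.nhds_eq x hx]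
  exact inf_le_left

/-- A chart maps neighbourhoods onto relative neighbourhoods in `C`, so what holds for `Φ y`,
for `y` near `x`, holds for the points of `C` near `Φ x`. -/
theorem map_nhds (h : X.IsChart C O Φ) (hx : x ∈ O) : map Φ (𝓝 x) = 𝓝[C] (Φ x) := by
  rw [h.nhds_eq x hx, Filter.push_pull', map_principal]
  refine le_antisymm (inf_le_inf_left _ (principal_mono.2 h.mapsTo.image_subset)) ?_
  exact le_inf nhdsWithin_le_nhds (le_principal_iff.2 (h.image_mem x hx))

theorem mono (h : X.IsChart C O Φ) {O' : Set X.Carrier} (hO' : IsOpen O') (hsub : O' ⊆ O) :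
    X.IsChart C O' Φ where
  isClosed := h.isClosed
  isOpen := hO'
  nhds_eq x hx := by
    have h1 : 𝓝 x = 𝓝 x ⊓ 𝓟 O' := (inf_eq_left.2 (le_principal_iff.2 (hO'.mem_nhds hx))).symm
    rw [h1, h.nhds_eq x (hsub hx), inf_assoc, inf_principal, inter_eq_right.2 hsub]
  mapsTo := h.mapsTo.mono_left hsub
  image_mem x hx := by
    rw [← h.map_nhds (hsub hx)]
    exact image_mem_map (hO'.mem_nhds hx)
  smooth_iff x hx := h.smooth_iff x (hsub hx)

end IsChart

theorem HasCharts.continuous (hX : X.HasCharts E) {f : X.Carrier → ℝ} (hf : f ∈ X.smooth) :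
    Continuous f := by
  refine continuous_iff_continuousAt.2 fun x => ?_
  obtain ⟨C, O, Φ, hx, h⟩ := hX.exists_isChart x
  obtain ⟨G, hG, hfG⟩ := (h.smooth_iff x hx f).1 ⟨f, hf, .rfl⟩
  exact (hG.continuous.continuousAt.comp (h.continuousAt hx)).congr hfG.symm

theorem HasCharts.exists_eventuallyEq_zero (hX : X.HasCharts E) (x : X.Carrier) :
    ∃ f' ∈ X.smooth, f' =ᶠ[𝓝 x] 0 := by
  obtain ⟨C, O, Φ, hx, h⟩ := hX.exists_isChart x
  exact (h.smooth_iff x hx 0).2 ⟨0, contDiff_const, .rfl⟩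

variable [FiniteDimensional ℝ E]

theorem IsChart.exists_isCompact_mem_nhds (h : X.IsChart C O Φ) {x : X.Carrier} (hx : x ∈ O) :
    ∃ K, IsCompact K ∧ K ∈ 𝓝 x := by
  obtain ⟨ε, hε, hsub⟩ :=
    (nhdsWithin_hasBasis Metric.nhds_basis_closedBall _).mem_iff.1 (h.image_mem x hx)
  refine ⟨O ∩ Φ ⁻¹' Metric.closedBall (Φ x) ε, ?_, inter_mem (h.mem_nhds hx)
    ((h.continuousAt hx).preimage_mem_nhds (Metric.closedBall_mem_nhds _ hε))⟩
  rw [isCompact_iff_ultrafilter_le_nhds']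
  intro F hF
  have hc : IsCompact (Metric.closedBall (Φ x) ε ∩ C) :=
    (isCompact_closedBall _ _).inter_right h.isClosed
  obtain ⟨c, hc, hFc⟩ := isCompact_iff_ultrafilter_le_nhds'.1 hc (F.map Φ)
    (Filter.mem_map.2 (mem_of_superset hF fun y hy => ⟨hy.2, h.mapsTo hy.1⟩))
  obtain ⟨y, hy, rfl⟩ := hsub hc
  refine ⟨y, ⟨hy, hc.1⟩, ?_⟩
  rw [h.nhds_eq y hy]
  exact le_inf (map_le_iff_le_comap.1 hFc)
    (le_principal_iff.2 (mem_of_superset hF inter_subset_left))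

/-- Regularity is what allows cutoff functions in a chart to be extended by zero. -/
theorem HasCharts.regularSpace (hX : X.HasCharts E) : RegularSpace X.Carrier := by
  have := hX.t2
  have : WeaklyLocallyCompactSpace X.Carrier := ⟨fun x => by
    obtain ⟨C, O, Φ, hx, h⟩ := hX.exists_isChart x
    exact h.exists_isCompact_mem_nhds hx⟩
  infer_instance

/-- Smooth functions in a chart, cut off near a point, extend by zero. -/
theorem IsChart.exists_cutoff (h : X.IsChart C O Φ) (hX : X.HasCharts E) {z : X.Carrier}
    (hz : z ∈ O) : ∃ κ : E → ℝ, κ =ᶠ[𝓝 (Φ z)] 1 ∧ ∀ G : E → ℝ, ContDiff ℝ ∞ G →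
      ∃ f ∈ X.smooth, (∀ x ∈ O, f x = κ (Φ x) * G (Φ x)) ∧ ∀ x ∉ O, f =ᶠ[𝓝 x] 0 := by
  classical
  have := hX.regularSpace
  obtain ⟨K, hK, hKc, hKO⟩ := exists_mem_nhds_isClosed_subset (h.mem_nhds hz)
  have hKz := hK
  rw [h.nhds_eq z hz, mem_inf_principal, mem_comap] at hKz
  obtain ⟨T, hT, hTK⟩ := hKz
  obtain ⟨ε, hε, hεT⟩ := Metric.mem_nhds_iff.1 hT
  let κ : ContDiffBump (Φ z) := ⟨ε / 4, ε / 2, by positivity, by linarith⟩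
  -- the support of the cutoff lies in `K`, which is closed in the whole space and not only in `O`
  have hA : ∀ x ∉ O, ∀ᶠ y in 𝓝 x, y ∈ O → κ (Φ y) = 0 := by
    intro x hx
    by_contra hcon
    have hfreq : ∃ᶠ y in 𝓝 x, y ∈ K := by
      refine (not_eventually.1 hcon).mono fun y hy => ?_
      push Not at hy
      refine hTK (hεT ?_) hy.1
      have : Φ y ∈ Function.support κ := hy.2
      rw [κ.support_eq] at this
      exact Metric.ball_subset_ball (by show ε / 2 ≤ ε; linarith) this
    exact hx (hKO (hKc.mem_of_frequently_of_tendsto hfreq tendsto_id))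
  refine ⟨κ, κ.eventuallyEq_one, fun G hG => ⟨fun x => if x ∈ O then κ (Φ x) * G (Φ x) else 0,
    ?_, fun x hx => if_pos hx, ?_⟩⟩
  · refine hX.smooth_of_locally _ fun x => ?_
    by_cases hx : x ∈ O
    · refine (h.smooth_iff x hx _).2 ⟨fun c => κ c * G c, κ.contDiff.mul hG, ?_⟩
      filter_upwards [h.mem_nhds hx] with y hy
      simp [hy]
    · obtain ⟨f', hf', hf0⟩ := hX.exists_eventuallyEq_zero x
      refine ⟨f', hf', ?_⟩
      filter_upwards [hf0, hA x hx] with y hy hy'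
      rw [hy]
      split_ifs with h'
      · simp [hy' h']
      · rfl
  · intro x hx
    filter_upwards [hA x hx] with y hy
    split_ifs with h'
    · simp [hy h']
    · rfl

theorem evalAt_eq_zero {Y : Set X.Carrier} {x : X.Carrier} (hx : x ∈ Y) : X.evalAt Y x = 0 :=
  funext fun f => f.2.2 x hx

/-- The ideal of a closed set has no further common zeros, so the graph in the definition of the
blow-up is a graph over the whole complement of the centre. -/
theorem HasCharts.evalAt_ne_zero_iff (hX : X.HasCharts E) {Y : Set X.Carrier} (hY : IsClosed Y)
    {x : X.Carrier} : X.evalAt Y x ≠ 0 ↔ x ∉ Y := by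
  refine ⟨fun h hx => h (evalAt_eq_zero hx), fun hx h0 => ?_⟩
  obtain ⟨C, O, Φ, hxO, h⟩ := hX.exists_isChart x
  have hx' : x ∈ O ∩ Yᶜ := ⟨hxO, hx⟩
  obtain ⟨κ, hκ, hf⟩ := (h.mono (h.isOpen.inter hY.isOpen_compl) inter_subset_left).exists_cutoff
    hX hx'
  obtain ⟨f, hfs, hf1, hf0⟩ := hf 1 contDiff_const
  have hfY : f ∈ X.ideal Y := ⟨hfs, fun y hy => (hf0 y fun h' => h'.2 hy).eq_of_nhds⟩
  have h1 : f x = 0 := congrFun h0 ⟨f, hfY⟩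
  have h2 : κ (Φ x) = 1 := hκ.eq_of_nhds
  rw [hf1 x hx', h2] at h1
  simp at h1

end SmoothSpace

/-! ### Directions over an adapted chart -/

namespace SmoothSpace

section coordVector

variable {E : Type} [NormedAddCommGroup E] [InnerProductSpace ℝ E] {X : SmoothSpace.{u}}
  {Y : Set X.Carrier} {n : ℕ} {b : OrthonormalBasis (Fin n) ℝ E} {g : Fin n → X.ideal Y}

/-- The vector with coordinates `v (g j)` in the basis `b`. -/
noncomputable def coordVector (b : OrthonormalBasis (Fin n) ℝ E) (g : Fin n → X.ideal Y)
    (v : X.ideal Y → ℝ) : E := ∑ j, v (g j) • b j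

theorem inner_coordVector (v : X.ideal Y → ℝ) (j : Fin n) :
    inner ℝ (b j) (coordVector b g v) = v (g j) := by
  rw [coordVector, inner_sum]
  simp [inner_smul_right, b.inner_eq_ite]

/-- The unit vector with the polar angle of a direction as coordinates. -/
noncomputable def polarVector (b : OrthonormalBasis (Fin n) ℝ E) (g : Fin n → X.ideal Y)
    (d : X.Direction Y) : E := ∑ j, polarAngle g d j • b j

/-- The direction of a point of the blow-up. -/
def direction (q : (X.blowUp Y).Carrier) : X.Direction Y := q.1.2

theorem continuous_direction : Continuous (X := (X.blowUp Y).Carrier) direction :=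
  continuous_snd.comp continuous_subtype_val

theorem norm_coordVector (v : X.ideal Y → ℝ) : ‖coordVector b g v‖ = √(∑ j, v (g j) ^ 2) := by
  rw [eq_comm, Real.sqrt_eq_iff_eq_sq (by positivity) (by positivity),
    ← b.sum_sq_norm_inner_right (coordVector b g v)]
  exact Finset.sum_congr rfl fun j _ => by rw [inner_coordVector, Real.norm_eq_abs, sq_abs]

theorem directionNorm_eq (d : X.Direction Y) :
    directionNorm g d = ‖coordVector b g d.someVector‖ := (norm_coordVector _).symm

theorem polarVector_eq (d : X.Direction Y) :
    polarVector b g d = ‖coordVector b g d.someVector‖⁻¹ • coordVector b g d.someVector := by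
  rw [polarVector, ← directionNorm_eq, coordVector, Finset.smul_sum]
  refine Finset.sum_congr rfl fun j _ => ?_
  rw [polarAngle, smul_smul, div_eq_inv_mul]

end coordVector

variable {E : Type} [NormedAddCommGroup E] [InnerProductSpace ℝ E] [FiniteDimensional ℝ E]

/-- A chart in which `Y` is the subspace orthogonal to `N`, in a set `C` invariant under
translation along `N`, and in which the coordinates along `N` in the orthonormal basis `b` are
given by the functions `g` in the ideal of `Y`. -/
structure IsAdaptedChart (X : SmoothSpace.{u}) (Y : Set X.Carrier) (C : Set E) (O : Set X.Carrier)
    (Φ : X.Carrier → E) (N : Submodule ℝ E) {n : ℕ} (b : OrthonormalBasis (Fin n) ℝ E)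
    (g : Fin n → X.ideal Y) : Prop extends X.IsChart C O Φ where
  add_mem : ∀ c ∈ C, ∀ n ∈ N, c + n ∈ C
  mem_iff : ∀ x ∈ O, x ∈ Y ↔ Φ x ∈ Nᗮ
  coord_eq : ∀ x ∈ O, ∀ j, (g j).1 x = inner ℝ (b j) (N.starProjection (Φ x))

variable {X : SmoothSpace.{u}} {Y : Set X.Carrier} {C : Set E} {O : Set X.Carrier}
  {Φ : X.Carrier → E} {N : Submodule ℝ E} {n : ℕ} {b : OrthonormalBasis (Fin n) ℝ E}
  {g : Fin n → X.ideal Y}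

/-- A chart in which `Y` is linear is adapted near each point: the coordinates along `N`, multiplied
by a cutoff function, are global functions in the ideal of `Y`. -/
theorem IsChart.exists_isAdaptedChart (h : X.IsChart C O Φ) (hX : X.HasCharts E)
    (hC : ∀ c ∈ C, ∀ n ∈ N, c + n ∈ C) (hY : ∀ x ∈ O, x ∈ Y ↔ Φ x ∈ Nᗮ)
    (b : OrthonormalBasis (Fin n) ℝ E) {z : X.Carrier} (hz : z ∈ O) :
    ∃ O' ⊆ O, z ∈ O' ∧ ∃ g : Fin n → X.ideal Y, X.IsAdaptedChart Y C O' Φ N b g := by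
  obtain ⟨κ, hκ, hf⟩ := h.exists_cutoff hX hz
  choose f hfs hf1 hf0 using fun j : Fin n =>
    hf (fun c => inner ℝ (b j) (N.starProjection c))
      (contDiff_const.inner ℝ N.starProjection.contDiff)
  have hfY : ∀ j, f j ∈ X.ideal Y := fun j => by
    refine ⟨hfs j, fun y hy => ?_⟩
    by_cases hyO : y ∈ O
    · rw [hf1 j y hyO, (N.starProjection_apply_eq_zero_iff).2 ((hY y hyO).1 hy)]
      simp
    · exact (hf0 j y hyO).eq_of_nhds
  have hz' : z ∈ {x | ∀ᶠ y in 𝓝 x, κ (Φ y) = 1} := (h.continuousAt hz).eventually hκ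
  have hopen : IsOpen (O ∩ {x | ∀ᶠ y in 𝓝 x, κ (Φ y) = 1}) :=
    h.isOpen.inter isOpen_setOfPred_eventually_nhds
  refine ⟨_, inter_subset_left, ⟨hz, hz'⟩, fun j => ⟨f j, hfY j⟩, ?_⟩
  exact { h.mono hopen inter_subset_left with
    add_mem := hC
    mem_iff := fun x hx => hY x hx.1
    coord_eq := fun x hx j => by
      have h1 : κ (Φ x) = 1 := hx.2.self_of_nhds
      show f j x = _
      rw [hf1 j x hx.1, h1, one_mul] }

namespace IsAdaptedChart

theorem coordVector_evalAt (h : X.IsAdaptedChart Y C O Φ N b g) {x : X.Carrier} (hx : x ∈ O) :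
    coordVector b g (X.evalAt Y x) = N.starProjection (Φ x) := by
  rw [coordVector, ← b.sum_repr' (N.starProjection (Φ x))]
  exact Finset.sum_congr rfl fun j _ => by rw [evalAt, h.coord_eq x hx]

/-- The coordinates along `N` generate the ideal of `Y` locally. -/
theorem exists_coeff (h : X.IsAdaptedChart Y C O Φ N b g) {x : X.Carrier} (hx : x ∈ O)
    (f : X.ideal Y) : ∃ a : E → (E →L[ℝ] ℝ), ContDiff ℝ ∞ a ∧
      ∀ᶠ y in 𝓝 x, f.1 y = a (Φ y) (N.starProjection (Φ y)) := by
  obtain ⟨G, hG, hfG⟩ := (h.smooth_iff x hx f.1).1 ⟨f.1, f.2.1, .rfl⟩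
  obtain ⟨a, ha, hGa⟩ := exists_contDiff_eq_apply_starProjection h.add_mem hG (c₀ := Φ x) (by
    have : ∀ᶠ c in 𝓝[C] (Φ x), c ∈ Nᗮ → G c = 0 := by
      rw [← h.map_nhds hx, eventually_map]
      filter_upwards [hfG, h.mem_nhds hx] with y hy hyO hyN
      rw [← Function.comp_apply (f := G), ← hy]
      exact f.2.2 y ((h.mem_iff y hyO).2 hyN)
    exact eventually_nhdsWithin_iff.1 this)
  refine ⟨a, ha, ?_⟩
  filter_upwards [hfG, h.mem_nhds hx, (h.continuousAt hx).eventually hGa] with y hy hyO hya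
  rw [hy]
  exact hya (h.mapsTo hyO)

/-- A point of the blow-up is a limit of points of `X` outside `Y`, and its ray is a limit of
suitably rescaled evaluations at them. -/
theorem exists_filter (h : X.IsAdaptedChart Y C O Φ N b g) (q : (X.blowUp Y).Carrier)
    (hq : X.blowDown Y q ∈ O) :
    ∃ F : Filter (X.Carrier × ℝ), F.NeBot ∧ (∀ᶠ p in F, 0 < p.2) ∧
      Tendsto Prod.fst F (𝓝 (X.blowDown Y q)) ∧
      (∀ f, Tendsto (fun p => p.2 * f.1 p.1) F (𝓝 ((direction q).someVector f))) ∧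
      Tendsto (fun p => p.2 • N.starProjection (Φ p.1)) F
        (𝓝 (coordVector b g (direction q).someVector)) := by
  have hq' := q.2
  have h1 : q.1 = (X.blowDown Y q, X.rayMk Y ⟨(direction q).someVector,
      (direction q).someVector_ne_zero⟩) := Prod.ext rfl (rayMk_someVector _).symm
  rw [h1, mem_closure_blowUpGraph_iff] at hq'
  obtain ⟨F, hF, hpos, hx, hv⟩ := hq'
  refine ⟨F, hF, hpos.mono fun p hp => hp.1, hx, hv, ?_⟩
  have h2 : Tendsto (fun p : X.Carrier × ℝ => ∑ j, (p.2 * (g j).1 p.1) • b j) F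
      (𝓝 (coordVector b g (direction q).someVector)) :=
    tendsto_finsetSum _ fun j _ => (hv (g j)).smul_const (b j)
  refine h2.congr' ?_
  filter_upwards [hx.eventually (h.mem_nhds hq)] with p hp
  rw [← h.coordVector_evalAt hp, coordVector, Finset.smul_sum]
  exact Finset.sum_congr rfl fun j _ => by rw [mul_smul]; rfl

/-- The value of a ray at `f = a · w`, with `w` the coordinates along `N`, is a linear function of
the values of that ray at the coordinates. -/
theorem someVector_apply_coordVector (h : X.IsAdaptedChart Y C O Φ N b g) {q : (X.blowUp Y).Carrier}
    (hq : X.blowDown Y q ∈ O) {f : X.ideal Y} {a : E → (E →L[ℝ] ℝ)} (ha : ContDiff ℝ ∞ a)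
    (hfa : ∀ᶠ y in 𝓝 (X.blowDown Y q), f.1 y = a (Φ y) (N.starProjection (Φ y))) :
    (direction q).someVector f =
      a (Φ (X.blowDown Y q)) (coordVector b g (direction q).someVector) := by
  obtain ⟨F, hF, hpos, hx, hv, hvec⟩ := h.exists_filter q hq
  refine tendsto_nhds_unique (hv f) ?_
  have h1 : Tendsto (fun p : X.Carrier × ℝ => a (Φ p.1)) F (𝓝 (a (Φ (X.blowDown Y q)))) :=
    (ha.continuous.tendsto _).comp ((h.continuousAt hq).tendsto.comp hx)
  refine ((isBoundedBilinearMap_apply.continuous.tendsto _).comp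
    (h1.prodMk_nhds hvec)).congr' ?_
  filter_upwards [hx.eventually hfa] with p hp
  simp only [Function.comp_apply, map_smul, smul_eq_mul, hp]

theorem coordVector_ne_zero (h : X.IsAdaptedChart Y C O Φ N b g) {q : (X.blowUp Y).Carrier}
    (hq : X.blowDown Y q ∈ O) : coordVector b g (direction q).someVector ≠ 0 := by
  intro h0
  refine (direction q).someVector_ne_zero (funext fun f => ?_)
  obtain ⟨a, ha, hfa⟩ := h.exists_coeff hq f
  rw [h.someVector_apply_coordVector hq ha hfa, h0, map_zero, Pi.zero_apply]

theorem directionNorm_pos (h : X.IsAdaptedChart Y C O Φ N b g) {q : (X.blowUp Y).Carrier}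
    (hq : X.blowDown Y q ∈ O) : 0 < directionNorm g (direction q) := by
  rw [directionNorm_eq (b := b)]
  exact norm_pos_iff.2 (h.coordVector_ne_zero hq)

/-- A direction is determined by its polar vector. -/
theorem someVector_apply (h : X.IsAdaptedChart Y C O Φ N b g) {q : (X.blowUp Y).Carrier}
    (hq : X.blowDown Y q ∈ O) {f : X.ideal Y} {a : E → (E →L[ℝ] ℝ)} (ha : ContDiff ℝ ∞ a)
    (hfa : ∀ᶠ y in 𝓝 (X.blowDown Y q), f.1 y = a (Φ y) (N.starProjection (Φ y))) :
    (direction q).someVector f = directionNorm g (direction q) *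
      a (Φ (X.blowDown Y q)) (polarVector b g (direction q)) := by
  have h1 : ‖coordVector b g (direction q).someVector‖ ≠ 0 :=
    norm_ne_zero_iff.2 (h.coordVector_ne_zero hq)
  rw [h.someVector_apply_coordVector hq ha hfa, polarVector_eq, directionNorm_eq (b := b), map_smul,
    smul_eq_mul, mul_inv_cancel_left₀ h1]

theorem norm_polarVector (h : X.IsAdaptedChart Y C O Φ N b g) {q : (X.blowUp Y).Carrier}
    (hq : X.blowDown Y q ∈ O) : ‖polarVector b g (direction q)‖ = 1 := by
  have h1 : ‖coordVector b g (direction q).someVector‖ ≠ 0 :=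
    norm_ne_zero_iff.2 (h.coordVector_ne_zero hq)
  rw [polarVector_eq, norm_smul, norm_inv, norm_norm, inv_mul_cancel₀ h1]

theorem polarVector_mem (h : X.IsAdaptedChart Y C O Φ N b g) {q : (X.blowUp Y).Carrier}
    (hq : X.blowDown Y q ∈ O) : polarVector b g (direction q) ∈ N := by
  obtain ⟨F, hF, hpos, hx, hv, hvec⟩ := h.exists_filter q hq
  rw [polarVector_eq]
  refine N.smul_mem _ ?_
  exact N.closed_of_finiteDimensional.mem_of_tendsto hvec
    (.of_forall fun p => N.smul_mem _ (N.starProjection_apply_mem _))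

/-- The component along `N` of the position of a point is its norm times the polar vector. -/
theorem starProjection_eq (h : X.IsAdaptedChart Y C O Φ N b g) {q : (X.blowUp Y).Carrier}
    (hq : X.blowDown Y q ∈ O) : N.starProjection (Φ (X.blowDown Y q)) =
      ‖N.starProjection (Φ (X.blowDown Y q))‖ • polarVector b g (direction q) := by
  have h1 : ‖coordVector b g (direction q).someVector‖ ≠ 0 :=
    norm_ne_zero_iff.2 (h.coordVector_ne_zero hq)
  obtain ⟨F, hF, hpos, hx, hv, hvec⟩ := h.exists_filter q hq
  have h2 : Tendsto (fun p : X.Carrier × ℝ => N.starProjection (Φ p.1)) F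
      (𝓝 (N.starProjection (Φ (X.blowDown Y q)))) :=
    (N.starProjection.continuous.tendsto _).comp ((h.continuousAt hq).tendsto.comp hx)
  have h3 : ‖coordVector b g (direction q).someVector‖ • N.starProjection (Φ (X.blowDown Y q)) =
      ‖N.starProjection (Φ (X.blowDown Y q))‖ • coordVector b g (direction q).someVector := by
    refine tendsto_nhds_unique (hvec.norm.smul h2) ((h2.norm.smul hvec).congr' ?_)
    filter_upwards [hpos] with p hp
    rw [norm_smul, Real.norm_of_nonneg hp.le, smul_smul, mul_comm]
  rw [polarVector_eq, smul_comm, ← h3, inv_smul_smul₀ h1]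

theorem continuousAt_polarVector (h : X.IsAdaptedChart Y C O Φ N b g)
    {q : (X.blowUp Y).Carrier} (hq : X.blowDown Y q ∈ O) :
    ContinuousAt (fun q : (X.blowUp Y).Carrier => polarVector b g (direction q)) q := by
  have h1 : ContinuousAt (fun q : (X.blowUp Y).Carrier => polarAngle g (direction q)) q :=
    ContinuousAt.comp (f := direction)
      (continuousAt_polarAngle (h.directionNorm_pos hq).ne') continuous_direction.continuousAt
  refine tendsto_finsetSum _ fun j _ => Tendsto.smul_const ?_ _
  exact (continuousAt_pi.1 h1 j)

theorem continuousAt_comp_blowDown (h : X.IsAdaptedChart Y C O Φ N b g)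
    {q : (X.blowUp Y).Carrier} (hq : X.blowDown Y q ∈ O) :
    ContinuousAt (fun q : (X.blowUp Y).Carrier => Φ (X.blowDown Y q)) q :=
  (h.continuousAt hq).comp (f := X.blowDown Y) continuous_blowDown.continuousAt

/-- Over an adapted chart, the topology of the blow-up is that of polar coordinates. -/
theorem comap_le_nhds (h : X.IsAdaptedChart Y C O Φ N b g)
    {q : (X.blowUp Y).Carrier} (hq : X.blowDown Y q ∈ O) :
    comap (fun q : (X.blowUp Y).Carrier => (Φ (X.blowDown Y q), polarVector b g (direction q)))
      (𝓝 (Φ (X.blowDown Y q), polarVector b g (direction q))) ⊓ 𝓟 (X.blowDown Y ⁻¹' O) ≤ 𝓝 q := by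
  set F := comap (fun q : (X.blowUp Y).Carrier =>
    (Φ (X.blowDown Y q), polarVector b g (direction q)))
      (𝓝 (Φ (X.blowDown Y q), polarVector b g (direction q))) ⊓ 𝓟 (X.blowDown Y ⁻¹' O) with hF
  have hO : ∀ᶠ p in F, X.blowDown Y p ∈ O := mem_inf_of_right (mem_principal_self _)
  have hpair := tendsto_comap.mono_left (inf_le_left : F ≤ _)
  have h1 : Tendsto (fun p => Φ (X.blowDown Y p)) F (𝓝 (Φ (X.blowDown Y q))) :=
    (continuous_fst.tendsto _).comp hpair
  have h2 : Tendsto (fun p => polarVector b g (direction p)) F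
      (𝓝 (polarVector b g (direction q))) := (continuous_snd.tendsto _).comp hpair
  have h3 : Tendsto (X.blowDown Y) F (𝓝 (X.blowDown Y q)) := by
    rw [h.nhds_eq _ hq]
    exact tendsto_inf.2 ⟨tendsto_comap_iff.2 h1, tendsto_principal.2 hO⟩
  have hN := h.directionNorm_pos hq
  -- normalized representatives are given by smooth coefficients and the polar vector
  have h4 : Tendsto direction F (𝓝 (direction q)) := by
    have hne : (directionNorm g (direction q))⁻¹ • (direction q).someVector ≠ 0 :=
      smul_ne_zero (inv_ne_zero hN.ne') (direction q).someVector_ne_zero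
    have hd : direction q = X.rayMk Y ⟨_, hne⟩ := by
      conv_lhs => rw [← rayMk_someVector (direction q)]
      exact (X.rayMk_eq_iff Y).2 ⟨_, inv_pos.2 hN, rfl⟩
    rw [hd]
    refine tendsto_direction
      (fun p => (directionNorm g (direction p))⁻¹ • (direction p).someVector) ?_ fun f => ?_
    · filter_upwards [hO] with p hp
      have hNp := h.directionNorm_pos hp
      refine ⟨smul_ne_zero (inv_ne_zero hNp.ne') (direction p).someVector_ne_zero, ?_⟩
      conv_lhs => rw [← rayMk_someVector (direction p)]
      exact (X.rayMk_eq_iff Y).2 ⟨_, inv_pos.2 hNp, rfl⟩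
    · obtain ⟨a, ha, hfa⟩ := h.exists_coeff hq f
      have hlim : Tendsto (fun p => a (Φ (X.blowDown Y p)) (polarVector b g (direction p))) F
          (𝓝 (a (Φ (X.blowDown Y q)) (polarVector b g (direction q)))) :=
        (isBoundedBilinearMap_apply.continuous.tendsto _).comp
          (((ha.continuous.tendsto _).comp h1).prodMk_nhds h2)
      have hval : ∀ p : (X.blowUp Y).Carrier, X.blowDown Y p ∈ O →
          (∀ᶠ y in 𝓝 (X.blowDown Y p), f.1 y = a (Φ y) (N.starProjection (Φ y))) →
          ((directionNorm g (direction p))⁻¹ • (direction p).someVector) f =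
            a (Φ (X.blowDown Y p)) (polarVector b g (direction p)) := by
        intro p hp hfp
        rw [Pi.smul_apply, smul_eq_mul, h.someVector_apply hp ha hfp,
          inv_mul_cancel_left₀ (h.directionNorm_pos hp).ne']
      rw [← hval q hq hfa] at hlim
      refine hlim.congr' ?_
      filter_upwards [hO, h3.eventually (eventually_eventually_nhds.2 hfa)] with p hp hfp
      exact (hval p hp hfp).symm
  have h5 : 𝓝 q = comap Subtype.val (𝓝 (X.blowDown Y q, direction q)) :=
    nhds_induced (T := (inferInstance : TopologicalSpace (X.Carrier × X.Direction Y)))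
      Subtype.val q
  rw [h5]
  exact map_le_iff_le_comap.1 (h3.prodMk_nhds h4)

/-- Every unit vector along `N` that is compatible with the position of `x` is the polar vector of
a point of the blow-up over `x`. -/
theorem exists_blowUp_point (h : X.IsAdaptedChart Y C O Φ N b g) (hX : X.HasCharts E)
    (hY : IsClosed Y) {x : X.Carrier} (hx : x ∈ O) {θ : E} (hθ : θ ∈ N) (hθ1 : ‖θ‖ = 1)
    (hxθ : N.starProjection (Φ x) = ‖N.starProjection (Φ x)‖ • θ) :
    ∃ q : (X.blowUp Y).Carrier, X.blowDown Y q = x ∧ polarVector b g (direction q) = θ := by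
  have hπθ : N.starProjection θ = θ := N.starProjection_eq_self_iff.2 hθ
  by_cases hxY : x ∈ Y
  · have hΦx : N.starProjection (Φ x) = 0 :=
      N.starProjection_apply_eq_zero_iff.2 ((h.mem_iff x hx).1 hxY)
    choose a ha hfa using fun f => h.exists_coeff hx f
    -- approach `x` along the ray with direction `θ`
    have hlim : Tendsto (fun ε : ℝ => Φ x + ε • θ) (𝓝[>] 0) (𝓝[C] (Φ x)) := by
      refine tendsto_nhdsWithin_iff.2 ⟨?_, .of_forall fun ε =>
        h.add_mem _ (h.mapsTo hx) _ (N.smul_mem _ hθ)⟩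
      have : Continuous fun ε : ℝ => Φ x + ε • θ := by fun_prop
      simpa using (this.tendsto 0).mono_left nhdsWithin_le_nhds
    have hS : ∀ᶠ ε : ℝ in 𝓝[>] 0, ∃ y ∈ O, Φ y = Φ x + ε • θ :=
      hlim.eventually (h.image_mem x hx)
    have hS' : ∃ y : ℝ → X.Carrier, ∀ᶠ ε : ℝ in 𝓝[>] 0, y ε ∈ O ∧ Φ (y ε) = Φ x + ε • θ := by
      classical
      refine ⟨fun ε => if hε : ∃ y ∈ O, Φ y = Φ x + ε • θ then hε.choose else x, ?_⟩
      filter_upwards [hS] with ε hε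
      simp only [dif_pos hε]
      exact hε.choose_spec
    obtain ⟨y, hy⟩ := hS'
    have hyx : Tendsto y (𝓝[>] 0) (𝓝 x) := by
      rw [h.nhds_eq x hx]
      refine tendsto_inf.2 ⟨tendsto_comap_iff.2 ?_, tendsto_principal.2 (hy.mono fun _ h => h.1)⟩
      exact (hlim.mono_right nhdsWithin_le_nhds).congr' (hy.mono fun _ h => h.2.symm)
    have hπy : ∀ᶠ ε : ℝ in 𝓝[>] 0, N.starProjection (Φ (y ε)) = ε • θ := by
      filter_upwards [hy] with ε hε
      rw [hε.2, map_add, map_smul, hΦx, hπθ, zero_add]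
    let v : X.ideal Y → ℝ := fun f => a f (Φ x) θ
    have hvf : ∀ f : X.ideal Y, Tendsto (fun ε : ℝ => ε⁻¹ * f.1 (y ε)) (𝓝[>] 0) (𝓝 (v f)) := by
      intro f
      have h1 : Tendsto (fun ε : ℝ => a f (Φ (y ε)) θ) (𝓝[>] 0) (𝓝 (v f)) :=
        (isBoundedBilinearMap_apply.continuous.tendsto (a f (Φ x), θ)).comp
          ((((ha f).continuous.tendsto _).comp
            ((h.continuousAt hx).tendsto.comp hyx)).prodMk_nhds tendsto_const_nhds)
      refine h1.congr' ?_
      filter_upwards [hyx.eventually (hfa f), hπy, self_mem_nhdsWithin] with ε h2 h3 h4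
      rw [h2, h3, map_smul, smul_eq_mul, inv_mul_cancel_left₀ (ne_of_gt h4)]
    have hvg : ∀ j, v (g j) = inner ℝ (b j) θ := by
      intro j
      refine tendsto_nhds_unique (hvf (g j)) (tendsto_const_nhds.congr' ?_)
      filter_upwards [hy, hπy, self_mem_nhdsWithin] with ε h2 h3 h4
      rw [h.coord_eq _ h2.1, h3, inner_smul_right, inv_mul_cancel_left₀ (ne_of_gt h4)]
    have hvec : coordVector b g v = θ := by
      rw [coordVector, ← b.sum_repr' θ]
      exact Finset.sum_congr rfl fun j _ => by rw [hvg]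
    have hv0 : v ≠ 0 := by
      intro h0
      have : θ = 0 := by rw [← hvec, h0]; simp [coordVector]
      simp [this] at hθ1
    have hmem : (x, X.rayMk Y ⟨v, hv0⟩) ∈ closure (X.blowUpGraph Y) := by
      refine mem_closure_blowUpGraph_iff.2
        ⟨map (fun ε : ℝ => (y ε, ε⁻¹)) (𝓝[>] 0), inferInstance, ?_, ?_, fun f => ?_⟩
      · rw [eventually_map]
        filter_upwards [hy, hπy, self_mem_nhdsWithin] with ε h2 h3 h4
        refine ⟨inv_pos.2 h4, (hX.evalAt_ne_zero_iff hY).2 fun h5 => ?_⟩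
        rw [h.mem_iff _ h2.1, ← N.starProjection_apply_eq_zero_iff, h3] at h5
        rcases smul_eq_zero.1 h5 with h6 | h6
        · exact (ne_of_gt h4) h6
        · simp [h6] at hθ1
      · exact tendsto_map'_iff.2 hyx
      · exact tendsto_map'_iff.2 (hvf f)
    refine ⟨⟨_, hmem⟩, rfl, ?_⟩
    obtain ⟨r, hr, hrv⟩ := exists_someVector_rayMk ⟨v, hv0⟩
    have h7 : coordVector b g (X.rayMk Y ⟨v, hv0⟩).someVector = r • θ := by
      rw [hrv, ← hvec, coordVector, coordVector, Finset.smul_sum]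
      exact Finset.sum_congr rfl fun j _ => by rw [Pi.smul_apply, smul_assoc]
    show polarVector b g (X.rayMk Y ⟨v, hv0⟩) = θ
    rw [polarVector_eq, h7, norm_smul, hθ1, mul_one, Real.norm_of_nonneg hr.le,
      inv_smul_smul₀ hr.ne']
  · refine ⟨graphPoint ((hX.evalAt_ne_zero_iff hY).2 hxY), rfl, ?_⟩
    have hΦx : N.starProjection (Φ x) ≠ 0 := fun h0 =>
      hxY ((h.mem_iff x hx).2 (N.starProjection_apply_eq_zero_iff.1 h0))
    set q : (X.blowUp Y).Carrier := graphPoint ((hX.evalAt_ne_zero_iff hY).2 hxY)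
    have h1 := h.starProjection_eq (q := q) hx
    have h2 : X.blowDown Y q = x := rfl
    rw [h2, hxθ, norm_smul, norm_norm, hθ1, mul_one] at h1
    exact (smul_right_injective _ (norm_ne_zero_iff.2 hΦx) h1).symm

end IsAdaptedChart

end SmoothSpace

/-! ### Projective coordinates on the front face -/

section PolarChart

variable {E : Type} [NormedAddCommGroup E] [InnerProductSpace ℝ E] [FiniteDimensional ℝ E]

/-- The point with position `y` and polar vector `θ` in the projective coordinates centred at the
unit vector `e` of `N`: the component of `y` orthogonal to `N` is kept, the unit vector `θ` is
replaced by its central projection to the tangent hyperplane at `e`, and the coordinate along `e`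
becomes the radial variable. -/
noncomputable def polarChart (N : Submodule ℝ E) (e y θ : E) : E :=
  y - N.starProjection y + ((inner ℝ θ e)⁻¹ • θ - e) + inner ℝ y e • e

/-- The multiple of the polar vector with component `1` along `e`, in projective coordinates. -/
noncomputable def polarSlope (N : Submodule ℝ E) (e c : E) : E :=
  N.starProjection c - inner ℝ c e • e + e

/-- The blow-down map in projective coordinates. -/
noncomputable def polarBlowDown (N : Submodule ℝ E) (e c : E) : E :=
  c - N.starProjection c + inner ℝ c e • polarSlope N e c

variable {N : Submodule ℝ E} {e c : E}

theorem contDiff_polarSlope : ContDiff ℝ ∞ (polarSlope N e) :=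
  (N.starProjection.contDiff.sub ((contDiff_id.inner ℝ contDiff_const).smul contDiff_const)).add
    contDiff_const

theorem contDiff_polarBlowDown : ContDiff ℝ ∞ (polarBlowDown N e) :=
  (contDiff_id.sub N.starProjection.contDiff).add
    ((contDiff_id.inner ℝ contDiff_const).smul contDiff_polarSlope)

theorem polarSlope_mem (he : e ∈ N) (c : E) : polarSlope N e c ∈ N :=
  N.add_mem (N.sub_mem (N.starProjection_apply_mem c) (N.smul_mem _ he)) he

theorem inner_starProjection_of_mem (he : e ∈ N) (c : E) :
    inner ℝ (N.starProjection c) e = inner ℝ c e := by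
  rw [N.inner_starProjection_left_eq_right, N.starProjection_eq_self_iff.2 he]

theorem inner_polarSlope (he : e ∈ N) (he1 : ‖e‖ = 1) (c : E) :
    inner ℝ (polarSlope N e c) e = 1 := by
  rw [polarSlope, inner_add_left, inner_sub_left, inner_starProjection_of_mem he,
    real_inner_smul_left, real_inner_self_eq_norm_sq, he1]
  ring

theorem polarSlope_ne_zero (he : e ∈ N) (he1 : ‖e‖ = 1) (c : E) : polarSlope N e c ≠ 0 := by
  intro h
  have := inner_polarSlope he he1 c
  rw [h, inner_zero_left] at this
  exact zero_ne_one this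

theorem starProjection_polarBlowDown (he : e ∈ N) (c : E) :
    N.starProjection (polarBlowDown N e c) = inner ℝ c e • polarSlope N e c := by
  rw [polarBlowDown, map_add, map_smul, map_sub,
    N.starProjection_eq_self_iff.2 (polarSlope_mem he c),
    N.starProjection_eq_self_iff.2 (N.starProjection_apply_mem c), sub_self, zero_add]

theorem polarBlowDown_mem_orthogonal_iff (he : e ∈ N) (he1 : ‖e‖ = 1) :
    polarBlowDown N e c ∈ Nᗮ ↔ inner ℝ c e = 0 := by
  rw [← N.starProjection_apply_eq_zero_iff, starProjection_polarBlowDown he, smul_eq_zero,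
    or_iff_left (polarSlope_ne_zero he he1 c)]

theorem inner_polarChart (he : e ∈ N) (he1 : ‖e‖ = 1) {y θ : E} (hθe : inner ℝ θ e ≠ 0) :
    inner ℝ (polarChart N e y θ) e = inner ℝ y e := by
  rw [polarChart, inner_add_left, inner_add_left, inner_sub_left, inner_sub_left,
    inner_starProjection_of_mem he, real_inner_smul_left, real_inner_smul_left,
    real_inner_self_eq_norm_sq, he1, inv_mul_cancel₀ hθe]
  ring

theorem starProjection_polarChart (he : e ∈ N) {y θ : E} (hθ : θ ∈ N) :
    N.starProjection (polarChart N e y θ) =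
      ((inner ℝ θ e)⁻¹ • θ - e) + inner ℝ y e • e := by
  rw [polarChart, map_add, map_add, map_sub, map_sub, map_smul, map_smul,
    N.starProjection_eq_self_iff.2 (N.starProjection_apply_mem y),
    N.starProjection_eq_self_iff.2 he, N.starProjection_eq_self_iff.2 hθ, sub_self, zero_add]

theorem polarSlope_polarChart (he : e ∈ N) (he1 : ‖e‖ = 1) {y θ : E} (hθ : θ ∈ N)
    (hθe : inner ℝ θ e ≠ 0) :
    polarSlope N e (polarChart N e y θ) = (inner ℝ θ e)⁻¹ • θ := by
  rw [polarSlope, starProjection_polarChart he hθ, inner_polarChart he he1 hθe]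
  abel

theorem polarBlowDown_polarChart (he : e ∈ N) (he1 : ‖e‖ = 1) {y θ : E} (hθ : θ ∈ N)
    (hθe : inner ℝ θ e ≠ 0) (hyθ : N.starProjection y = ‖N.starProjection y‖ • θ) :
    polarBlowDown N e (polarChart N e y θ) = y := by
  rw [polarBlowDown, polarSlope_polarChart he he1 hθ hθe, starProjection_polarChart he hθ,
    inner_polarChart he he1 hθe, smul_smul, ← inner_starProjection_of_mem he y]
  have h1 : inner ℝ (N.starProjection y) e * (inner ℝ θ e)⁻¹ = ‖N.starProjection y‖ := by
    conv_lhs => rw [hyθ]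
    rw [real_inner_smul_left, mul_inv_cancel_right₀ hθe]
  rw [h1, ← hyθ, inner_starProjection_of_mem he, polarChart]
  abel

/-- Together with `polarBlowDown_polarChart`: projective coordinates identify the half space `0 ≤
⟨c, e⟩` with the pairs of a position and a compatible polar vector that has a positive component
along `e`. -/
theorem polarChart_polarBlowDown (he : e ∈ N) (he1 : ‖e‖ = 1) (c : E) :
    polarChart N e (polarBlowDown N e c) (‖polarSlope N e c‖⁻¹ • polarSlope N e c) = c := by
  have h1 : ‖polarSlope N e c‖ ≠ 0 := norm_ne_zero_iff.2 (polarSlope_ne_zero he he1 c)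
  have h2 : inner ℝ (polarBlowDown N e c) e = inner ℝ c e := by
    rw [← inner_starProjection_of_mem he, starProjection_polarBlowDown he, real_inner_smul_left,
      inner_polarSlope he he1, mul_one]
  rw [polarChart, h2, starProjection_polarBlowDown he, real_inner_smul_left,
    inner_polarSlope he he1, mul_one, inv_inv, smul_inv_smul₀ h1, polarBlowDown, polarSlope]
  abel

theorem polarBlowDown_mem {C : Set E} (hC : ∀ c ∈ C, ∀ n ∈ N, c + n ∈ C) (he : e ∈ N)
    (hc : c ∈ C) : polarBlowDown N e c ∈ C := by
  rw [polarBlowDown, sub_add_eq_add_sub, add_sub_assoc]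
  exact hC c hc _ (N.sub_mem (N.smul_mem _ (polarSlope_mem he c)) (N.starProjection_apply_mem c))

theorem polarChart_mem {C : Set E} (hC : ∀ c ∈ C, ∀ n ∈ N, c + n ∈ C) (he : e ∈ N) {y θ : E}
    (hθ : θ ∈ N) (hy : y ∈ C) : polarChart N e y θ ∈ C := by
  have : polarChart N e y θ = y +
      (-N.starProjection y + ((inner ℝ θ e)⁻¹ • θ - e) + inner ℝ y e • e) := by
    rw [polarChart]; abel
  rw [this]
  exact hC y hy _ (N.add_mem (N.add_mem (N.neg_mem (N.starProjection_apply_mem y))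
    (N.sub_mem (N.smul_mem _ hθ) he)) (N.smul_mem _ he))

theorem contDiffOn_polarChart :
    ContDiffOn ℝ ∞ (fun p : E × E => polarChart N e p.1 p.2) {p | inner ℝ p.2 e ≠ 0} := by
  have h1 : ContDiffOn ℝ ∞ (fun p : E × E => (inner ℝ p.2 e)⁻¹) {p | inner ℝ p.2 e ≠ 0} :=
    (contDiff_snd.inner ℝ contDiff_const).contDiffOn.inv fun p hp => hp
  have h2 : ContDiff ℝ ∞ (fun p : E × E => p.1 - N.starProjection p.1) :=
    contDiff_fst.sub (N.starProjection.contDiff.comp contDiff_fst)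
  have h3 : ContDiff ℝ ∞ (fun p : E × E => inner ℝ p.1 e • e) :=
    (contDiff_fst.inner ℝ contDiff_const).smul contDiff_const
  exact (h2.contDiffOn.add ((h1.smul contDiff_snd.contDiffOn).sub contDiffOn_const)).add
    h3.contDiffOn

end PolarChart

namespace SmoothSpace

variable {E : Type} [NormedAddCommGroup E] [InnerProductSpace ℝ E] [FiniteDimensional ℝ E]
  {X : SmoothSpace.{u}} {Y : Set X.Carrier} {C : Set E} {O : Set X.Carrier}
  {Φ : X.Carrier → E} {N : Submodule ℝ E} {n : ℕ} {b : OrthonormalBasis (Fin n) ℝ E}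
  {g : Fin n → X.ideal Y} {e : E} {q : (X.blowUp Y).Carrier}

/-- The projective coordinates, centred at `e`, of a point of the blow-up. -/
noncomputable def blowUpCoord (Φ : X.Carrier → E) (N : Submodule ℝ E)
    (b : OrthonormalBasis (Fin n) ℝ E) (g : Fin n → X.ideal Y) (e : E)
    (q : (X.blowUp Y).Carrier) : E :=
  polarChart N e (Φ (X.blowDown Y q)) (polarVector b g (direction q))

/-- The points over `O` whose polar vector has a positive component along `e`. -/
def blowUpDomain (O : Set X.Carrier) (b : OrthonormalBasis (Fin n) ℝ E) (g : Fin n → X.ideal Y)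
    (e : E) : Set (X.blowUp Y).Carrier :=
  {q | X.blowDown Y q ∈ O ∧ 0 < inner ℝ (polarVector b g (direction q)) e}

/-- Near every point of the blow-up, some polar coordinates are defined. -/
theorem exists_directionNorm_ne_zero (q : (X.blowUp Y).Carrier) :
    ∃ f : Fin 1 → X.ideal Y, ∀ᶠ p in 𝓝 q, directionNorm f (direction p) ≠ 0 := by
  obtain ⟨f, hf⟩ := Function.ne_iff.1 (direction q).someVector_ne_zero
  refine ⟨fun _ => f, ?_⟩
  refine continuous_direction.continuousAt.eventually
    ((isOpen_directionNorm_ne_zero _).mem_nhds ?_)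
  show √(∑ _j : Fin 1, (direction q).someVector f ^ 2) ≠ 0
  rw [Finset.univ_unique, Finset.sum_singleton, Real.sqrt_sq_eq_abs]
  exact abs_ne_zero.2 hf

namespace IsAdaptedChart

theorem isOpen_blowUpDomain (h : X.IsAdaptedChart Y C O Φ N b g) :
    IsOpen (blowUpDomain O b g e) := by
  rw [isOpen_iff_mem_nhds]
  intro q hq
  refine inter_mem (continuous_blowDown.continuousAt (h.mem_nhds hq.1)) ?_
  have : ContinuousAt (fun q : (X.blowUp Y).Carrier =>
      inner ℝ (polarVector b g (direction q)) e) q :=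
    (h.continuousAt_polarVector hq.1).inner continuousAt_const
  exact this.eventually (lt_mem_nhds hq.2)

theorem polarSlope_blowUpCoord (h : X.IsAdaptedChart Y C O Φ N b g) (he : e ∈ N) (he1 : ‖e‖ = 1)
    (hq : q ∈ blowUpDomain O b g e) : polarSlope N e (blowUpCoord Φ N b g e q) =
      (inner ℝ (polarVector b g (direction q)) e)⁻¹ • polarVector b g (direction q) :=
  polarSlope_polarChart he he1 (h.polarVector_mem hq.1) hq.2.ne'

theorem polarBlowDown_blowUpCoord (h : X.IsAdaptedChart Y C O Φ N b g) (he : e ∈ N)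
    (he1 : ‖e‖ = 1) (hq : q ∈ blowUpDomain O b g e) :
    polarBlowDown N e (blowUpCoord Φ N b g e q) = Φ (X.blowDown Y q) :=
  polarBlowDown_polarChart he he1 (h.polarVector_mem hq.1) hq.2.ne' (h.starProjection_eq hq.1)

theorem polarVector_eq_blowUpCoord (h : X.IsAdaptedChart Y C O Φ N b g) (he : e ∈ N)
    (he1 : ‖e‖ = 1) (hq : q ∈ blowUpDomain O b g e) : polarVector b g (direction q) =
      ‖polarSlope N e (blowUpCoord Φ N b g e q)‖⁻¹ • polarSlope N e (blowUpCoord Φ N b g e q) := by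
  rw [h.polarSlope_blowUpCoord he he1 hq, norm_smul, h.norm_polarVector hq.1, mul_one,
    Real.norm_of_nonneg (inv_pos.2 hq.2).le, inv_inv, smul_inv_smul₀ hq.2.ne']

theorem continuousAt_blowUpCoord (h : X.IsAdaptedChart Y C O Φ N b g)
    (hq : q ∈ blowUpDomain O b g e) : ContinuousAt (blowUpCoord Φ N b g e) q := by
  have hopen : IsOpen {p : E × E | inner ℝ p.2 e ≠ 0} :=
    isOpen_ne_fun (continuous_snd.inner continuous_const) continuous_const
  have h1 : ContinuousAt (fun p : E × E => polarChart N e p.1 p.2)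
      (Φ (X.blowDown Y q), polarVector b g (direction q)) :=
    contDiffOn_polarChart.continuousOn.continuousAt (hopen.mem_nhds hq.2.ne')
  exact ContinuousAt.comp (f := fun q : (X.blowUp Y).Carrier =>
    (Φ (X.blowDown Y q), polarVector b g (direction q))) h1
    ((h.continuousAt_comp_blowDown hq.1).prodMk (h.continuousAt_polarVector hq.1))

theorem inner_blowUpCoord_nonneg (h : X.IsAdaptedChart Y C O Φ N b g) (he : e ∈ N)
    (he1 : ‖e‖ = 1) (hq : q ∈ blowUpDomain O b g e) :
    0 ≤ inner ℝ (blowUpCoord Φ N b g e q) e := by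
  rw [blowUpCoord, inner_polarChart he he1 hq.2.ne', ← inner_starProjection_of_mem he,
    h.starProjection_eq hq.1, real_inner_smul_left]
  exact mul_nonneg (norm_nonneg _) hq.2.le

/-- Smooth functions on the blow-up are smooth in projective coordinates. -/
theorem exists_contDiff_of_smooth (h : X.IsAdaptedChart Y C O Φ N b g) (he : e ∈ N)
    (he1 : ‖e‖ = 1) (hq : q ∈ blowUpDomain O b g e) {φ : (X.blowUp Y).Carrier → ℝ}
    (hφ : φ ∈ (X.blowUp Y).smooth) :
    ∃ G : E → ℝ, ContDiff ℝ ∞ G ∧ φ =ᶠ[𝓝 q] G ∘ blowUpCoord Φ N b g e := by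
  obtain ⟨U, hU, m, k, hs, f, G, hsX, hG, hφG⟩ := hφ q
  choose H hH hhH using fun i => (h.smooth_iff _ hq.1 (hs i)).1 ⟨hs i, hsX i, .rfl⟩
  choose a ha hfa using fun j => h.exists_coeff hq.1 (f j)
  -- at the point with coordinates `c`, the function `f j` is `⟨c, e⟩ * A j c`
  let A : Fin k → E → ℝ := fun j c => a j (polarBlowDown N e c) (polarSlope N e c)
  let R : E → ℝ := fun c => ∑ j, A j c ^ 2
  have hA : ∀ j, ContDiff ℝ ∞ (A j) := fun j =>
    ((ha j).comp contDiff_polarBlowDown).clm_apply contDiff_polarSlope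
  have hR : ContDiff ℝ ∞ R := ContDiff.sum fun j _ => (hA j).pow 2
  -- the polar coordinates of `f` in terms of the projective coordinates
  have key : ∀ p ∈ blowUpDomain O b g e, (∀ j, ∀ᶠ y in 𝓝 (X.blowDown Y p),
      (f j).1 y = a j (Φ y) (N.starProjection (Φ y))) →
      (directionNorm f (direction p) ≠ 0 → R (blowUpCoord Φ N b g e p) ≠ 0) ∧
      polarRadius f (X.blowDown Y p) =
        inner ℝ (blowUpCoord Φ N b g e p) e * √(R (blowUpCoord Φ N b g e p)) ∧
      ∀ j, polarAngle f (direction p) j =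
        A j (blowUpCoord Φ N b g e p) / √(R (blowUpCoord Φ N b g e p)) := by
    intro p hp hfp
    set c := blowUpCoord Φ N b g e p with hc
    set s := directionNorm g (direction p) * inner ℝ (polarVector b g (direction p)) e with hs
    have hs0 : 0 < s := mul_pos (h.directionNorm_pos hp.1) hp.2
    have h1 : ∀ j, (direction p).someVector (f j) = s * A j c := by
      intro j
      rw [h.someVector_apply hp.1 (ha j) (hfp j)]
      simp only [A, hs]
      rw [h.polarBlowDown_blowUpCoord he he1 hp, h.polarSlope_blowUpCoord he he1 hp, map_smul,
        smul_eq_mul, mul_assoc, mul_inv_cancel_left₀ hp.2.ne']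
    have h2 : directionNorm f (direction p) = s * √(R c) := by
      have : ∑ j, (direction p).someVector (f j) ^ 2 = s ^ 2 * R c := by
        rw [Finset.mul_sum]
        exact Finset.sum_congr rfl fun j _ => by rw [h1, mul_pow]
      rw [directionNorm, this, Real.sqrt_mul (by positivity), Real.sqrt_sq hs0.le]
    refine ⟨fun h3 h4 => h3 (by rw [h2, h4, Real.sqrt_zero, mul_zero]), ?_, fun j => ?_⟩
    · have h5 : ∀ j, (f j).1 (X.blowDown Y p) = inner ℝ c e * A j c := by
        intro j
        rw [(hfp j).self_of_nhds, ← h.polarBlowDown_blowUpCoord he he1 hp,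
          starProjection_polarBlowDown he, map_smul, smul_eq_mul]
      have : ∑ j, (f j).1 (X.blowDown Y p) ^ 2 = inner ℝ c e ^ 2 * R c := by
        rw [Finset.mul_sum]
        exact Finset.sum_congr rfl fun j _ => by rw [h5, mul_pow]
      rw [polarRadius, this, Real.sqrt_mul (by positivity),
        Real.sqrt_sq (h.inner_blowUpCoord_nonneg he he1 hp)]
    · rw [polarAngle, h2, h1, mul_div_mul_left _ _ hs0.ne']
  let F : E → ℝ := fun c => G (fun i => H i (polarBlowDown N e c), inner ℝ c e * √(R c),
    fun j => A j c / √(R c))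
  have hF : ContDiffOn ℝ ∞ F {c | R c ≠ 0} := by
    have hsq : ContDiffOn ℝ ∞ (fun c => √(R c)) {c | R c ≠ 0} :=
      hR.contDiffOn.sqrt fun c hc => hc
    refine hG.comp_contDiffOn (ContDiffOn.prodMk ?_ (ContDiffOn.prodMk ?_ ?_))
    · exact (contDiff_pi.2 fun i => (hH i).comp contDiff_polarBlowDown).contDiffOn
    · exact (contDiff_id.inner ℝ contDiff_const).contDiffOn.mul hsq
    · refine contDiffOn_pi.2 fun j => (hA j).contDiffOn.div hsq fun c hc => ?_
      exact (Real.sqrt_ne_zero (Finset.sum_nonneg fun j _ => sq_nonneg _)).2 hc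
  have hqR := (key q hq hfa).1 (hφG q (mem_of_mem_nhds hU)).1
  obtain ⟨G', hG', hGF⟩ := hF.exists_contDiff_eventuallyEq
    (isOpen_ne_fun hR.continuous continuous_const) hqR
  refine ⟨G', hG', ?_⟩
  have hb : Tendsto (X.blowDown Y) (𝓝 q) (𝓝 (X.blowDown Y q)) := continuous_blowDown.continuousAt
  filter_upwards [hU, h.isOpen_blowUpDomain.mem_nhds hq,
    (h.continuousAt_blowUpCoord hq).eventually hGF,
    hb.eventually (eventually_all.2 fun j => eventually_eventually_nhds.2 (hfa j)),
    hb.eventually (eventually_all.2 hhH)] with p hpU hp hpG hpf hph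
  obtain ⟨-, h2, h3⟩ := key p hp hpf
  have h4 : polarAngle f p.1.2 = fun j =>
      A j (blowUpCoord Φ N b g e p) / √(R (blowUpCoord Φ N b g e p)) := funext h3
  have h5 : (fun i => hs i p.1.1) = fun i => H i (polarBlowDown N e (blowUpCoord Φ N b g e p)) :=
    funext fun i => by
      rw [h.polarBlowDown_blowUpCoord he he1 hp]
      exact hph i
  rw [(hφG p hpU).2, Function.comp_apply, hpG, h4, h5]
  exact congrArg G (Prod.ext rfl (Prod.ext h2 rfl))

/-- Smooth functions of projective coordinates are germs of smooth functions on the blow-up. -/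
theorem exists_smooth_of_contDiff (h : X.IsAdaptedChart Y C O Φ N b g) (hX : X.HasCharts E)
    (hq : q ∈ blowUpDomain O b g e) {G : E → ℝ} (hG : ContDiff ℝ ∞ G) :
    ∃ φ ∈ (X.blowUp Y).smooth, φ =ᶠ[𝓝 q] G ∘ blowUpCoord Φ N b g e := by
  obtain ⟨κ, hκ, hf⟩ := h.exists_cutoff hX hq.1
  obtain ⟨f₀, hf₀X, hf₀, hf₀0⟩ := hf 1 contDiff_const
  choose f hfX hf1 hf0 using fun j : Fin n =>
    hf (fun c => inner ℝ (b j) c) (contDiff_const.inner ℝ contDiff_id)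
  have hopen : IsOpen {p : E × E | inner ℝ p.2 e ≠ 0} :=
    isOpen_ne_fun (continuous_snd.inner continuous_const) continuous_const
  obtain ⟨P, hP, hPG⟩ := (hG.comp_contDiffOn
    (contDiffOn_polarChart (N := N) (e := e))).exists_contDiff_eventuallyEq hopen
      (x := (Φ (X.blowDown Y q), polarVector b g (direction q))) hq.2.ne'
  let Q : (Fin (n + 1) → ℝ) × ℝ × (Fin n → ℝ) → ℝ := fun t =>
    t.1 0 * P (∑ j, t.1 j.succ • b j, ∑ j, t.2.2 j • b j)
  have hc0 : ∀ j : Fin (n + 1), ContDiff ℝ ∞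
      (fun t : (Fin (n + 1) → ℝ) × ℝ × (Fin n → ℝ) => t.1 j) := fun j =>
    (contDiff_apply ℝ ℝ j).comp contDiff_fst
  have hc1 : ∀ j : Fin n, ContDiff ℝ ∞
      (fun t : (Fin (n + 1) → ℝ) × ℝ × (Fin n → ℝ) => t.2.2 j) := fun j =>
    (contDiff_apply ℝ ℝ j).comp (contDiff_snd.comp contDiff_snd)
  have hQ : ContDiff ℝ ∞ Q := (hc0 0).mul (hP.comp
    ((ContDiff.sum fun j _ => (hc0 j.succ).smul contDiff_const).prodMk
      (ContDiff.sum fun j _ => (hc1 j).smul contDiff_const)))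
  -- the function `f₀` is the cutoff itself, and the `f j` are the cut off coordinates
  let hs : Fin (n + 1) → X.Carrier → ℝ := Fin.cons f₀ f
  let φ : (X.blowUp Y).Carrier → ℝ := fun p => Q (fun i => hs i (X.blowDown Y p),
    polarRadius g (X.blowDown Y p), polarAngle g (direction p))
  refine ⟨φ, fun p => ?_, ?_⟩
  · by_cases hp : X.blowDown Y p ∈ O
    · refine ⟨X.blowDown Y ⁻¹' O, continuous_blowDown.continuousAt (h.mem_nhds hp), n + 1, n, hs,
        g, Q, Fin.cases hf₀X hfX, hQ, fun p' hp' => ⟨(h.directionNorm_pos hp').ne', rfl⟩⟩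
    · obtain ⟨f', hf'⟩ := exists_directionNorm_ne_zero p
      refine ⟨_, inter_mem hf' (continuous_blowDown.continuousAt (hf₀0 _ hp)), 0, 1,
        Fin.elim0, f', fun _ => 0, fun i => i.elim0, contDiff_const, fun p' hp' => ⟨hp'.1, ?_⟩⟩
      have : f₀ (X.blowDown Y p') = 0 := hp'.2
      show f₀ (X.blowDown Y p') * _ = 0
      rw [this, zero_mul]
  · have hpair : ContinuousAt (fun q : (X.blowUp Y).Carrier =>
        (Φ (X.blowDown Y q), polarVector b g (direction q))) q :=
      (h.continuousAt_comp_blowDown hq.1).prodMk (h.continuousAt_polarVector hq.1)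
    filter_upwards [hpair.eventually hPG, h.isOpen_blowUpDomain.mem_nhds hq,
      (h.continuousAt_comp_blowDown hq.1).eventually hκ] with p hp hpO hpκ
    have hκ1 : κ (Φ (X.blowDown Y p)) = 1 := hpκ
    have h0 : f₀ (X.blowDown Y p) = 1 := by rw [hf₀ _ hpO.1, hκ1]; simp
    have h1 : ∑ j, f j (X.blowDown Y p) • b j = Φ (X.blowDown Y p) := by
      conv_rhs => rw [← b.sum_repr' (Φ (X.blowDown Y p))]
      exact Finset.sum_congr rfl fun j _ => by rw [hf1 j _ hpO.1, hκ1, one_mul]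
    show f₀ (X.blowDown Y p) * P (∑ j, f j (X.blowDown Y p) • b j,
      ∑ j, polarAngle g (direction p) j • b j) = _
    rw [h0, one_mul, h1]
    exact hp

/-- Projective coordinates are a chart of the blow-up. -/
theorem isChart_blowUpCoord (h : X.IsAdaptedChart Y C O Φ N b g) (hX : X.HasCharts E)
    (hY : IsClosed Y) (he : e ∈ N) (he1 : ‖e‖ = 1) :
    (X.blowUp Y).IsChart (C ∩ {c | 0 ≤ inner ℝ c e}) (blowUpDomain O b g e)
      (blowUpCoord Φ N b g e) where
  isClosed := h.isClosed.inter
    (isClosed_le continuous_const (continuous_id.inner continuous_const))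
  isOpen := h.isOpen_blowUpDomain
  nhds_eq q hq := by
    refine le_antisymm (le_inf (tendsto_iff_comap.1 (h.continuousAt_blowUpCoord hq))
      (le_principal_iff.2 (h.isOpen_blowUpDomain.mem_nhds hq))) ?_
    refine le_trans (le_inf (tendsto_iff_comap.1 ?_) (inf_le_right.trans
      (principal_mono.2 fun p hp => hp.1))) (h.comap_le_nhds hq.1)
    set F := comap (blowUpCoord Φ N b g e) (𝓝 (blowUpCoord Φ N b g e q)) ⊓
      𝓟 (blowUpDomain O b g e)
    have hO : ∀ᶠ p in F, p ∈ blowUpDomain O b g e := mem_inf_of_right (mem_principal_self _)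
    have ht : Tendsto (blowUpCoord Φ N b g e) F (𝓝 (blowUpCoord Φ N b g e q)) :=
      tendsto_comap.mono_left inf_le_left
    have hs := (contDiff_polarSlope (N := N) (e := e)).continuous
    refine Tendsto.prodMk_nhds ?_ ?_
    · rw [← h.polarBlowDown_blowUpCoord he he1 hq]
      refine ((contDiff_polarBlowDown.continuous.tendsto _).comp ht).congr' ?_
      filter_upwards [hO] with p hp
      exact h.polarBlowDown_blowUpCoord he he1 hp
    · rw [h.polarVector_eq_blowUpCoord he he1 hq]
      have hs' := (hs.tendsto _).comp ht
      refine ((hs'.norm.inv₀ (norm_ne_zero_iff.2 (polarSlope_ne_zero he he1 _))).smul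
        hs').congr' ?_
      filter_upwards [hO] with p hp
      exact (h.polarVector_eq_blowUpCoord he he1 hp).symm
  mapsTo q hq := ⟨polarChart_mem h.add_mem he (h.polarVector_mem hq.1) (h.mapsTo hq.1),
    h.inner_blowUpCoord_nonneg he he1 hq⟩
  image_mem q hq := by
    have ht : Tendsto (polarBlowDown N e) (𝓝[C ∩ {c | 0 ≤ inner ℝ c e}] (blowUpCoord Φ N b g e q))
        (𝓝[C] (Φ (X.blowDown Y q))) := by
      refine tendsto_nhdsWithin_iff.2 ⟨?_, ?_⟩
      · rw [← h.polarBlowDown_blowUpCoord he he1 hq]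
        exact (contDiff_polarBlowDown.continuous.tendsto _).mono_left nhdsWithin_le_nhds
      · filter_upwards [self_mem_nhdsWithin] with c hc
        exact polarBlowDown_mem h.add_mem he hc.1
    filter_upwards [ht (h.image_mem _ hq.1), self_mem_nhdsWithin] with c hc hcC
    obtain ⟨x, hx, hxc⟩ := hc
    have hs0 := norm_ne_zero_iff.2 (polarSlope_ne_zero he he1 c)
    obtain ⟨p, rfl, hpθ⟩ := h.exists_blowUp_point hX hY hx
      (θ := ‖polarSlope N e c‖⁻¹ • polarSlope N e c) (N.smul_mem _ (polarSlope_mem he c))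
      (by rw [norm_smul, norm_inv, norm_norm, inv_mul_cancel₀ hs0]) (by
        rw [hxc, starProjection_polarBlowDown he, norm_smul, Real.norm_of_nonneg hcC.2,
          smul_smul, mul_assoc, mul_inv_cancel₀ hs0, mul_one])
    refine ⟨p, ⟨hx, ?_⟩, ?_⟩
    · rw [hpθ, real_inner_smul_left, inner_polarSlope he he1, mul_one]
      positivity
    · rw [blowUpCoord, hpθ, hxc, polarChart_polarBlowDown he he1]
  smooth_iff q hq f := by
    constructor
    · rintro ⟨f', hf', hff'⟩
      obtain ⟨G, hG, hfG⟩ := h.exists_contDiff_of_smooth he he1 hq hf'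
      exact ⟨G, hG, hff'.symm.trans hfG⟩
    · rintro ⟨G, hG, hfG⟩
      obtain ⟨f', hf', hff'⟩ := h.exists_smooth_of_contDiff hX hq hG
      exact ⟨f', hf', hff'.trans hfG.symm⟩

end IsAdaptedChart

end SmoothSpace

/-! ### Charts of the blow-up, and lifts -/

namespace SmoothSpace

variable {E : Type} [NormedAddCommGroup E] [InnerProductSpace ℝ E] [FiniteDimensional ℝ E]
  {X : SmoothSpace.{u}} {Y : Set X.Carrier} {C : Set E} {O : Set X.Carrier}
  {Φ : X.Carrier → E} {N : Submodule ℝ E} {n : ℕ} {b : OrthonormalBasis (Fin n) ℝ E}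
  {g : Fin n → X.ideal Y} {e : E} {q : (X.blowUp Y).Carrier}

/-- Outside the centre, the blow-up has a single point over each point, whose ray is the evaluation.
-/
theorem HasCharts.direction_eq (hX : X.HasCharts E) (hY : IsClosed Y)
    (hq : X.blowDown Y q ∉ Y) :
    direction q = X.rayMk Y ⟨X.evalAt Y (X.blowDown Y q), (hX.evalAt_ne_zero_iff hY).2 hq⟩ := by
  have hq' := q.2
  have h1 : q.1 = (X.blowDown Y q, X.rayMk Y ⟨(direction q).someVector,
      (direction q).someVector_ne_zero⟩) := Prod.ext rfl (rayMk_someVector _).symm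
  rw [h1, mem_closure_blowUpGraph_iff] at hq'
  obtain ⟨F, hF, hpos, hx, hv⟩ := hq'
  obtain ⟨f₀, hf₀⟩ := Function.ne_iff.1 ((hX.evalAt_ne_zero_iff hY).2 hq)
  have hf₀' : f₀.1 (X.blowDown Y q) ≠ 0 := hf₀
  have hlim : ∀ f : X.ideal Y, Tendsto (fun p : X.Carrier × ℝ => f.1 p.1) F
      (𝓝 (f.1 (X.blowDown Y q))) := fun f => ((hX.continuous f.2.1).tendsto _).comp hx
  have ht : Tendsto (fun p : X.Carrier × ℝ => p.2) F
      (𝓝 ((direction q).someVector f₀ / f₀.1 (X.blowDown Y q))) := by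
    refine ((hv f₀).div (hlim f₀) hf₀').congr' ?_
    filter_upwards [(hlim f₀).eventually_ne hf₀'] with p hp
    exact mul_div_cancel_right₀ _ hp
  set t := (direction q).someVector f₀ / f₀.1 (X.blowDown Y q)
  have hvt : t • X.evalAt Y (X.blowDown Y q) = (direction q).someVector :=
    funext fun f => tendsto_nhds_unique (ht.mul (hlim f)) (hv f)
  have ht0 : 0 ≤ t := ge_of_tendsto ht (hpos.mono fun p hp => hp.1.le)
  have ht1 : t ≠ 0 := fun h0 => (direction q).someVector_ne_zero (by rw [← hvt, h0, zero_smul])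
  conv_lhs => rw [← rayMk_someVector (direction q)]
  exact ((X.rayMk_eq_iff Y).2 ⟨t, lt_of_le_of_ne ht0 ht1.symm, hvt⟩).symm

/-- Outside the centre, the blow-down map is a local homeomorphism. -/
theorem HasCharts.nhds_eq_comap_blowDown (hX : X.HasCharts E) (hY : IsClosed Y)
    (hq : X.blowDown Y q ∉ Y) : 𝓝 q = comap (X.blowDown Y) (𝓝 (X.blowDown Y q)) := by
  refine le_antisymm (tendsto_iff_comap.1 continuous_blowDown.continuousAt) ?_
  have h1 : Tendsto (X.blowDown Y) (comap (X.blowDown Y) (𝓝 (X.blowDown Y q)))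
      (𝓝 (X.blowDown Y q)) := tendsto_comap
  have h2 : Tendsto direction (comap (X.blowDown Y) (𝓝 (X.blowDown Y q))) (𝓝 (direction q)) := by
    rw [hX.direction_eq hY hq]
    refine tendsto_direction (fun p => X.evalAt Y (X.blowDown Y p)) ?_ fun f =>
      ((hX.continuous f.2.1).tendsto _).comp h1
    filter_upwards [h1 (hY.isOpen_compl.mem_nhds hq)] with p hp
    exact ⟨_, hX.direction_eq hY hp⟩
  have h5 : 𝓝 q = comap Subtype.val (𝓝 (X.blowDown Y q, direction q)) :=
    nhds_induced (T := (inferInstance : TopologicalSpace (X.Carrier × X.Direction Y)))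
      Subtype.val q
  rw [h5]
  exact map_le_iff_le_comap.1 (h1.prodMk_nhds h2)

theorem comp_blowDown_mem_smooth {f : X.Carrier → ℝ} (hf : f ∈ X.smooth) :
    f ∘ X.blowDown Y ∈ (X.blowUp Y).smooth := by
  intro p
  obtain ⟨f', hf'⟩ := exists_directionNorm_ne_zero p
  exact ⟨_, hf', 1, 1, fun _ => f, f', fun t => t.1 0, fun _ => hf,
    (contDiff_apply ℝ ℝ 0).comp contDiff_fst, fun p' hp' => ⟨hp', rfl⟩⟩

/-- A chart that avoids the centre is also a chart of the blow-up.  The polar coordinates of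
functions without common zeros are smooth functions there, and so give nothing new. -/
theorem IsChart.comp_blowDown (h : X.IsChart C O Φ) (hX : X.HasCharts E) (hY : IsClosed Y)
    (hOY : ∀ x ∈ O, x ∉ Y) : (X.blowUp Y).IsChart C (X.blowDown Y ⁻¹' O) (Φ ∘ X.blowDown Y) where
  isClosed := h.isClosed
  isOpen := h.isOpen.preimage continuous_blowDown
  nhds_eq q hq := by
    rw [hX.nhds_eq_comap_blowDown hY (hOY _ hq), h.nhds_eq _ hq, comap_inf, comap_comap,
      comap_principal]
    rfl
  mapsTo q hq := h.mapsTo hq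
  image_mem q hq := by
    refine mem_of_superset (h.image_mem _ hq) ?_
    rintro _ ⟨x, hx, rfl⟩
    exact ⟨graphPoint ((hX.evalAt_ne_zero_iff hY).2 (hOY x hx)), hx, rfl⟩
  smooth_iff q hq f := by
    have hb : Tendsto (X.blowDown Y) (𝓝 q) (𝓝 (X.blowDown Y q)) :=
      continuous_blowDown.continuousAt
    constructor
    · rintro ⟨φ, hφ, hφf⟩
      obtain ⟨U, hU, m, k, hs, f', G, hsX, hG, hφG⟩ := hφ q
      choose H hH hhH using fun i => (h.smooth_iff _ hq (hs i)).1 ⟨hs i, hsX i, .rfl⟩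
      choose K hK hfK using fun j => (h.smooth_iff _ hq (f' j).1).1 ⟨(f' j).1, (f' j).2.1, .rfl⟩
      let R : E → ℝ := fun c => ∑ j, K j c ^ 2
      have hR : ContDiff ℝ ∞ R := ContDiff.sum fun j _ => (hK j).pow 2
      let F : E → ℝ := fun c => G (fun i => H i c, √(R c), fun j => K j c / √(R c))
      have hF : ContDiffOn ℝ ∞ F {c | R c ≠ 0} := by
        have hsq : ContDiffOn ℝ ∞ (fun c => √(R c)) {c | R c ≠ 0} :=
          hR.contDiffOn.sqrt fun c hc => hc
        refine hG.comp_contDiffOn (ContDiffOn.prodMk ?_ (ContDiffOn.prodMk hsq ?_))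
        · exact (contDiff_pi.2 fun i => hH i).contDiffOn
        · refine contDiffOn_pi.2 fun j => (hK j).contDiffOn.div hsq fun c hc => ?_
          exact (Real.sqrt_ne_zero (Finset.sum_nonneg fun j _ => sq_nonneg _)).2 hc
      have hqR : R (Φ (X.blowDown Y q)) ≠ 0 := by
        have h1 : directionNorm f' (direction q) ≠ 0 := (hφG q (mem_of_mem_nhds hU)).1
        rw [hX.direction_eq hY (hOY _ hq), directionNorm_rayMk_ne_zero_iff] at h1
        have h2 : R (Φ (X.blowDown Y q)) = ∑ j, X.evalAt Y (X.blowDown Y q) (f' j) ^ 2 :=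
          Finset.sum_congr rfl fun j _ => congrArg (· ^ 2) (hfK j).eq_of_nhds.symm
        rwa [h2]
      obtain ⟨G', hG', hGF⟩ := hF.exists_contDiff_eventuallyEq
        (isOpen_ne_fun hR.continuous continuous_const) hqR
      refine ⟨G', hG', ?_⟩
      filter_upwards [hU, hφf, hb (h.mem_nhds hq),
        hb.eventually ((h.continuousAt hq).eventually hGF),
        hb.eventually (eventually_all.2 hhH), hb.eventually (eventually_all.2 hfK)]
        with p hpU hpf hpO hpG hph hpK
      have h1 : (fun i => hs i p.1.1) = fun i => H i (Φ (X.blowDown Y p)) := funext hph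
      have h2 : ∑ j, (f' j).1 (X.blowDown Y p) ^ 2 = R (Φ (X.blowDown Y p)) :=
        Finset.sum_congr rfl fun j _ => congrArg (· ^ 2) (hpK j)
      have h3 : polarAngle f' p.1.2 = fun j =>
          K j (Φ (X.blowDown Y p)) / √(R (Φ (X.blowDown Y p))) := by
        funext j
        show polarAngle f' (direction p) j = _
        rw [hX.direction_eq hY (hOY _ hpO), polarAngle_rayMk, ← h2]
        exact congrArg (· / _) (hpK j)
      rw [← hpf, (hφG p hpU).2, Function.comp_apply, Function.comp_apply, hpG, h1, h3]
      exact congrArg G (Prod.ext rfl (Prod.ext (congrArg Real.sqrt h2) rfl))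
    · rintro ⟨G, hG, hfG⟩
      obtain ⟨f', hf', hfG'⟩ := (h.smooth_iff _ hq (G ∘ Φ)).2 ⟨G, hG, .rfl⟩
      exact ⟨_, comp_blowDown_mem_smooth hf', EventuallyEq.trans (hb.eventually hfG') hfG.symm⟩

/-- The blow-up of a closed set that is linear in charts has charts. -/
theorem HasCharts.blowUp (hX : X.HasCharts E) (hY : IsClosed Y)
    (hYc : ∀ y ∈ Y, ∃ (C : Set E) (O : Set X.Carrier) (Φ : X.Carrier → E) (N : Submodule ℝ E),
      y ∈ O ∧ X.IsChart C O Φ ∧ (∀ c ∈ C, ∀ n ∈ N, c + n ∈ C) ∧ ∀ x ∈ O, x ∈ Y ↔ Φ x ∈ Nᗮ) :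
    (X.blowUp Y).HasCharts E where
  t2 := by
    have := hX.t2
    infer_instance
  smooth_of_locally f hf q := by
    obtain ⟨f', hf', hff'⟩ := hf q
    obtain ⟨U, hU, m, k, hs, g, G, hsX, hG, hφG⟩ := hf' q
    refine ⟨_, inter_mem hU hff', m, k, hs, g, G, hsX, hG, fun p hp => ⟨(hφG p hp.1).1, ?_⟩⟩
    have : f' p = f p := hp.2
    rw [← this, (hφG p hp.1).2]
  exists_isChart q := by
    by_cases hq : X.blowDown Y q ∈ Y
    · obtain ⟨C, O, Φ, N, hqO, h, hC, hO⟩ := hYc _ hq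
      obtain ⟨O', hO', hqO', g, hg⟩ :=
        h.exists_isAdaptedChart hX hC hO (stdOrthonormalBasis ℝ E) hqO
      refine ⟨_, _, _, ?_, hg.isChart_blowUpCoord hX hY (hg.polarVector_mem hqO')
        (hg.norm_polarVector hqO')⟩
      refine ⟨hqO', ?_⟩
      rw [real_inner_self_eq_norm_sq, hg.norm_polarVector hqO']
      norm_num
    · obtain ⟨C, O, Φ, hqO, h⟩ := hX.exists_isChart (X.blowDown Y q)
      have hqO' : X.blowDown Y q ∈ O ∩ Yᶜ := ⟨hqO, hq⟩
      exact ⟨_, _, _, hqO', (h.mono (h.isOpen.inter hY.isOpen_compl)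
        inter_subset_left).comp_blowDown hX hY fun x hx => hx.2⟩

theorem isClosed_lift (W : Set X.Carrier) : IsClosed (X.lift Y W) := isClosed_closure

theorem lift_subset {W : Set X.Carrier} (hW : IsClosed W) : X.lift Y W ⊆ X.blowDown Y ⁻¹' W :=
  closure_minimal (preimage_mono sdiff_subset) (hW.preimage continuous_blowDown)

theorem mem_lift_iff_of_notMem {W : Set X.Carrier} (hW : IsClosed W)
    (hq : X.blowDown Y q ∉ Y) : q ∈ X.lift Y W ↔ X.blowDown Y q ∈ W :=
  ⟨fun h => lift_subset hW h, fun h => subset_closure ⟨h, hq⟩⟩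

/-- The lift of a set `W`, given by `W₀` in an adapted chart, in projective coordinates: it is
enough to describe it where the radial variable is positive. -/
theorem IsAdaptedChart.mem_lift_iff (h : X.IsAdaptedChart Y C O Φ N b g) (hX : X.HasCharts E)
    (hY : IsClosed Y) (he : e ∈ N) (he1 : ‖e‖ = 1) (hq : q ∈ blowUpDomain O b g e)
    {W : Set X.Carrier} {W₀ W₁ : Set E} (hW : ∀ x ∈ O, x ∈ W ↔ Φ x ∈ W₀) (hW₁ : IsClosed W₁)
    (hadd : ∀ c ∈ W₁, ∀ ε : ℝ, 0 < ε → c + ε • e ∈ W₁)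
    (hiff : ∀ᶠ c in 𝓝[C] (blowUpCoord Φ N b g e q), 0 < inner ℝ c e →
      (polarBlowDown N e c ∈ W₀ ↔ c ∈ W₁)) :
    q ∈ X.lift Y W ↔ blowUpCoord Φ N b g e q ∈ W₁ := by
  have hchart := h.isChart_blowUpCoord hX hY he he1
  have hmap := hchart.map_nhds hq
  have hiff' : ∀ᶠ c in 𝓝[C ∩ {c | 0 ≤ inner ℝ c e}] (blowUpCoord Φ N b g e q), 0 < inner ℝ c e →
      (polarBlowDown N e c ∈ W₀ ↔ c ∈ W₁) :=
    hiff.filter_mono (nhdsWithin_mono _ inter_subset_left)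
  have hnear : ∀ᶠ p in 𝓝 q, (p ∈ X.blowDown Y ⁻¹' (W \ Y) ↔
      blowUpCoord Φ N b g e p ∈ W₁ ∧ 0 < inner ℝ (blowUpCoord Φ N b g e p) e) := by
    rw [← hmap, eventually_map] at hiff'
    filter_upwards [hiff', hchart.mem_nhds hq] with p hp hpO
    have h1 : X.blowDown Y p ∈ Y ↔ inner ℝ (blowUpCoord Φ N b g e p) e = 0 := by
      rw [h.mem_iff _ hpO.1, ← h.polarBlowDown_blowUpCoord he he1 hpO,
        polarBlowDown_mem_orthogonal_iff he he1]
    have h2 := h.inner_blowUpCoord_nonneg he he1 hpO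
    rw [mem_preimage, Set.mem_sdiff, hW _ hpO.1, h1, ← h.polarBlowDown_blowUpCoord he he1 hpO]
    constructor
    · rintro ⟨h3, h4⟩
      have h5 := lt_of_le_of_ne h2 (Ne.symm h4)
      exact ⟨(hp h5).1 h3, h5⟩
    · rintro ⟨h3, h4⟩
      exact ⟨(hp h4).2 h3, h4.ne'⟩
  constructor
  -- the lift is the closure of its part with positive radial variable
  · intro hmem
    have hfreq : ∃ᶠ p in 𝓝 q, blowUpCoord Φ N b g e p ∈ W₁ :=
      ((mem_closure_iff_frequently.1 hmem).and_eventually hnear).mono fun p hp => (hp.2.1 hp.1).1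
    exact hW₁.mem_of_frequently_of_tendsto hfreq (hchart.continuousAt hq)
  -- translation along `e` moves points of `W₁` off the front face
  · intro hmem
    have hC := hchart.mapsTo hq
    have hlim : Tendsto (fun ε : ℝ => blowUpCoord Φ N b g e q + ε • e) (𝓝[>] 0)
        (𝓝[C ∩ {c | 0 ≤ inner ℝ c e}] (blowUpCoord Φ N b g e q)) := by
      refine tendsto_nhdsWithin_iff.2 ⟨?_, ?_⟩
      · have : Continuous fun ε : ℝ => blowUpCoord Φ N b g e q + ε • e := by fun_prop
        simpa using (this.tendsto 0).mono_left nhdsWithin_le_nhds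
      · filter_upwards [self_mem_nhdsWithin] with ε hε
        refine ⟨h.add_mem _ hC.1 _ (N.smul_mem _ he), ?_⟩
        have hε' : (0 : ℝ) < ε := hε
        have h6 : 0 ≤ inner ℝ (blowUpCoord Φ N b g e q) e := hC.2
        show 0 ≤ inner ℝ _ e
        rw [inner_add_left, real_inner_smul_left, real_inner_self_eq_norm_sq, he1]
        nlinarith
    have hfreq : ∃ᶠ c in 𝓝[C ∩ {c | 0 ≤ inner ℝ c e}] (blowUpCoord Φ N b g e q),
        c ∈ W₁ ∧ 0 < inner ℝ c e := by
      refine hlim.frequently (Eventually.frequently ?_)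
      filter_upwards [self_mem_nhdsWithin] with ε hε
      have hε' : (0 : ℝ) < ε := hε
      have h6 : 0 ≤ inner ℝ (blowUpCoord Φ N b g e q) e := hC.2
      refine ⟨hadd _ hmem _ hε, ?_⟩
      rw [inner_add_left, real_inner_smul_left, real_inner_self_eq_norm_sq, he1]
      nlinarith
    rw [← hmap, frequently_map] at hfreq
    exact mem_closure_iff_frequently.2
      ((hfreq.and_eventually hnear).mono fun p hp => hp.2.2 hp.1)

end SmoothSpace

/-! ### The manifold `M^k` -/

/-- The Euclidean space of configurations of `k` points in `ℂ`. -/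
abbrev ConfigVec (k : ℕ) : Type := PiLp 2 (fun _ : Fin k => ℂ)

section Product

variable {M : Type u} [TopologicalSpace M] [ChartedSpace ℂ M]

/-- The real model with corners of `M^k`. -/
noncomputable abbrev configModel (k : ℕ) :=
  ModelWithCorners.pi (fun _ : Fin k => 𝓘(ℝ, ℂ))

theorem isManifold_pi_of_complex [IsManifold 𝓘(ℂ, ℂ) ω M] (k : ℕ) :
    IsManifold (configModel k) ∞ (Fin k → M) := by
  refine isManifold_of_contDiffOn _ _ _ ?_
  rintro _ _ ⟨e, he, rfl⟩ ⟨e', he', rfl⟩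
  rw [contDiffOn_pi]
  intro i
  have h1 := (contDiffGroupoid ω 𝓘(ℂ, ℂ)).compatible (he i (mem_univ i)) (he' i (mem_univ i))
  have h2 : ContDiffOn ℂ ω (e' i ∘ (e i).symm) ((e i).symm ≫ₕ e' i).source := by
    rw [contDiffGroupoid, mem_groupoid_of_pregroupoid] at h1
    simpa [contDiffPregroupoid] using h1.1
  have h3 : ContDiffOn ℝ ∞ (e' i ∘ (e i).symm) ((e i).symm ≫ₕ e' i).source :=
    (h2.restrict_scalars ℝ).of_le (by simp)
  refine h3.comp (contDiff_apply ℝ ℂ i).contDiffOn ?_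
  rintro c ⟨hc, -⟩
  exact ⟨hc.1 i (mem_univ i), hc.2 i (mem_univ i)⟩

/-- The coordinates of `M^k` centred at `p`, as a Euclidean vector. -/
noncomputable def configCoord {k : ℕ} (p x : Fin k → M) : ConfigVec k :=
  WithLp.toLp 2 (extChartAt (configModel k) p x - extChartAt (configModel k) p p)

theorem configCoord_apply {k : ℕ} (p x : Fin k → M) (i : Fin k) :
    configCoord p x i = chartAt ℂ (p i) (x i) - chartAt ℂ (p i) (p i) := rfl

theorem configCoord_self {k : ℕ} (p : Fin k → M) : configCoord p p = 0 := by
  rw [configCoord, sub_self]; rfl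

theorem mem_source_iff {k : ℕ} (p x : Fin k → M) :
    x ∈ (chartAt (ModelPi fun _ : Fin k => ℂ) p).source ↔ ∀ i, x i ∈ (chartAt ℂ (p i)).source :=
  ⟨fun h i => h i (mem_univ i), fun h i _ => h i⟩

/-- The chart of `M^k` as a local homeomorphism to the Euclidean space. -/
noncomputable def configPartialHomeomorph {k : ℕ} (p : Fin k → M) :
    OpenPartialHomeomorph (Fin k → M) (ConfigVec k) :=
  (chartAt (ModelPi fun _ : Fin k => ℂ) p).transHomeomorph
    ((Homeomorph.subRight (extChartAt (configModel k) p p)).trans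
      (PiLp.continuousLinearEquiv 2 ℝ (fun _ : Fin k => ℂ)).symm.toHomeomorph)

/-- Near a point of the chart centred at `p`, the smooth functions are those of the coordinates. -/
theorem exists_contMDiff_iff_exists_contDiff [T2Space M] [IsManifold 𝓘(ℂ, ℂ) ω M] {k : ℕ}
    (p : Fin k → M) {x : Fin k → M} (hx : x ∈ (chartAt (ModelPi fun _ : Fin k => ℂ) p).source)
    (f : (Fin k → M) → ℝ) :
    (∃ f', ContMDiff (configModel k) 𝓘(ℝ, ℝ) ∞ f' ∧ f' =ᶠ[𝓝 x] f) ↔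
      ∃ G : ConfigVec k → ℝ, ContDiff ℝ ∞ G ∧ f =ᶠ[𝓝 x] G ∘ configCoord p := by
  have := isManifold_pi_of_complex (M := M) k
  have hsrc : (extChartAt (configModel k) p).source =
      (chartAt (ModelPi fun _ : Fin k => ℂ) p).source := extChartAt_source _ _
  let c₀ := extChartAt (configModel k) p p
  constructor
  · rintro ⟨f', hf', hff'⟩
    have h1 : ContDiffOn ℝ ∞ (f' ∘ (extChartAt (configModel k) p).symm)
        (extChartAt (configModel k) p).target := by
      rw [← contMDiffOn_iff_contDiffOn]
      exact hf'.comp_contMDiffOn (contMDiffOn_extChartAt_symm p)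
    let A : ConfigVec k → (Fin k → ℂ) := fun v => WithLp.ofLp v + c₀
    have hA : ContDiff ℝ ∞ A :=
      (PiLp.continuousLinearEquiv 2 ℝ (fun _ : Fin k => ℂ)).contDiff.add contDiff_const
    have htar : IsOpen (extChartAt (configModel k) p).target := by
      have : range (configModel k) = univ := by
        rw [eq_univ_iff_forall]
        exact fun v => ⟨v, rfl⟩
      rw [extChartAt_target, this, inter_univ]
      exact (chartAt (ModelPi fun _ : Fin k => ℂ) p).open_target.preimage
        (configModel k).continuous_symm
    have hAΦ : ∀ y, A (configCoord p y) = extChartAt (configModel k) p y := fun y =>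
      sub_add_cancel _ _
    have hx' : x ∈ (extChartAt (configModel k) p).source := hsrc ▸ hx
    obtain ⟨G, hG, hGf⟩ := (h1.comp hA.contDiffOn
      (mapsTo_preimage A _)).exists_contDiff_eventuallyEq (htar.preimage hA.continuous)
      (x := configCoord p x) (by
        rw [mem_preimage, hAΦ]
        exact (extChartAt (configModel k) p).map_source hx')
    refine ⟨G, hG, ?_⟩
    have hcont : ContinuousAt (configCoord p) x := (configPartialHomeomorph p).continuousAt hx
    filter_upwards [hff', hcont.eventually hGf,
      (chartAt (ModelPi fun _ : Fin k => ℂ) p).open_source.mem_nhds hx] with y h2 h3 h4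
    rw [← h2, Function.comp_apply, h3, Function.comp_apply, Function.comp_apply, hAΦ,
      (extChartAt (configModel k) p).left_inv (hsrc ▸ h4)]
  · rintro ⟨G, hG, hfG⟩
    obtain ⟨χ, hχ⟩ := (SmoothBumpFunction.nhds_basis_tsupport (I := configModel k) x).mem_iff.1
      ((chartAt (ModelPi fun _ : Fin k => ℂ) p).open_source.mem_nhds hx)
    have hΦ : ContMDiffOn (configModel k) 𝓘(ℝ, ConfigVec k) ∞ (configCoord p)
        (chartAt (ModelPi fun _ : Fin k => ℂ) p).source := by
      have h1 : ContMDiffOn (configModel k) 𝓘(ℝ, Fin k → ℂ) ∞ (extChartAt (configModel k) p)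
        (chartAt (ModelPi fun _ : Fin k => ℂ) p).source := contMDiffOn_extChartAt
      have h2 : ContDiff ℝ ∞ (fun v : Fin k → ℂ => (WithLp.toLp 2 (v - c₀) : ConfigVec k)) :=
        (PiLp.continuousLinearEquiv 2 ℝ (fun _ : Fin k => ℂ)).symm.contDiff.comp
          (contDiff_id.sub contDiff_const)
      exact h2.contMDiff.comp_contMDiffOn h1
    refine ⟨fun y => χ y • G (configCoord p y), ?_, ?_⟩
    · refine contMDiff_of_tsupport fun y hy => ?_
      have hy' : y ∈ (chartAt (ModelPi fun _ : Fin k => ℂ) p).source :=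
        hχ.2 (tsupport_smul_subset_left _ _ hy)
      exact χ.contMDiffAt.smul (hG.contMDiff.contMDiffAt.comp y ((hΦ y hy').contMDiffAt
        ((chartAt (ModelPi fun _ : Fin k => ℂ) p).open_source.mem_nhds hy')))
    · filter_upwards [χ.eventuallyEq_one, hfG] with y h1 h2
      rw [h2, h1]
      simp

theorem isChart_configCoord [T2Space M] [IsManifold 𝓘(ℂ, ℂ) ω M] {k : ℕ} (p : Fin k → M) :
    (configSpace M k).IsChart univ (chartAt (ModelPi fun _ : Fin k => ℂ) p).source
      (configCoord p) where
  isClosed := isClosed_univ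
  isOpen := (chartAt (ModelPi fun _ : Fin k => ℂ) p).open_source
  nhds_eq x hx := (configPartialHomeomorph p).nhds_eq_comap_inf_principal hx
  mapsTo x hx := mem_univ _
  image_mem x hx := by
    rw [nhdsWithin_univ]
    exact (configPartialHomeomorph p).image_mem_nhds hx
      ((configPartialHomeomorph p).open_source.mem_nhds hx)
  smooth_iff x hx f := exists_contMDiff_iff_exists_contDiff p hx f

theorem hasCharts_configSpace [T2Space M] [IsManifold 𝓘(ℂ, ℂ) ω M] (k : ℕ) :
    (configSpace M k).HasCharts (ConfigVec k) where
  t2 := inferInstanceAs (T2Space (Fin k → M))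
  smooth_of_locally f hf := by
    show ContMDiff (M := Fin k → M) (configModel k) 𝓘(ℝ, ℝ) ∞ f
    intro x
    obtain ⟨f', hf', hff'⟩ := hf x
    have : ContMDiff (M := Fin k → M) (configModel k) 𝓘(ℝ, ℝ) ∞ f' := hf'
    exact this.contMDiffAt.congr_of_eventuallyEq hff'.symm
  exists_isChart x :=
    ⟨_, _, _, mem_chart_source (ModelPi fun _ : Fin k => ℂ) (M := Fin k → M) x,
      isChart_configCoord x⟩

end Product

/-! ### Diagonal subspaces -/

/-- The space of configurations in `ℂ^k` whose points with index in `J` coincide. -/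
def diagSubspace {k : ℕ} (J : Finset (Fin k)) : Submodule ℝ (ConfigVec k) where
  carrier := {v | ∀ i ∈ J, ∀ j ∈ J, v i = v j}
  add_mem' {v w} hv hw i hi j hj := by
    show v i + w i = v j + w j
    rw [hv i hi j hj, hw i hi j hj]
  zero_mem' _ _ _ _ := rfl
  smul_mem' r v hv i hi j hj := by
    show r • v i = r • v j
    rw [hv i hi j hj]

section diagSubspace

variable {k : ℕ} {I J : Finset (Fin k)}

theorem diagSubspace_anti (h : I ⊆ J) : diagSubspace J ≤ diagSubspace I :=
  fun _ hv i hi j hj => hv i (h hi) j (h hj)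

theorem diagSubspace_union {v : ConfigVec k} (hI : v ∈ diagSubspace I) (hJ : v ∈ diagSubspace J)
    (h : (I ∩ J).Nonempty) : v ∈ diagSubspace (I ∪ J) := by
  obtain ⟨m, hm⟩ := h
  rw [Finset.mem_inter] at hm
  have : ∀ i ∈ I ∪ J, v i = v m := fun i hi => by
    rcases Finset.mem_union.1 hi with h | h
    · exact hI i h m hm.1
    · exact hJ i h m hm.2
  exact fun i hi j hj => (this i hi).trans (this j hj).symm

/-- A normal vector of the diagonal of `I` is supported on `I`. -/
theorem orthogonal_diagSubspace_le (h : Disjoint J I) : (diagSubspace I)ᗮ ≤ diagSubspace J := by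
  intro v hv
  have key : ∀ i ∈ J, v i = 0 := by
    intro i hi
    have hmem : (PiLp.single 2 i (v i) : ConfigVec k) ∈ diagSubspace I := by
      intro a ha b hb
      have hne : ∀ a ∈ I, a ≠ i := fun a ha hai =>
        Finset.disjoint_left.1 h hi (hai ▸ ha)
      simp [hne a ha, hne b hb]
    have h0 := (Submodule.mem_orthogonal _ _).1 hv _ hmem
    rw [PiLp.inner_apply, Finset.sum_eq_single i] at h0
    · simpa using h0
    · intro b _ hb
      simp [hb]
    · simp
  exact fun i hi j hj => (key i hi).trans (key j hj).symm

end diagSubspace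

section

variable {E : Type} [NormedAddCommGroup E] [InnerProductSpace ℝ E] [FiniteDimensional ℝ E]
  {N W : Submodule ℝ E} {e c : E}

theorem polarBlowDown_sub_mem (he : e ∈ N) (c : E) : polarBlowDown N e c - c ∈ N := by
  have : polarBlowDown N e c - c = inner ℝ c e • polarSlope N e c - N.starProjection c := by
    rw [polarBlowDown]; abel
  rw [this]
  exact N.sub_mem (N.smul_mem _ (polarSlope_mem he c)) (N.starProjection_apply_mem c)

/-- A subspace containing the normal space is its own lift. -/
theorem polarBlowDown_mem_iff_of_le (he : e ∈ N) (hNW : N ≤ W) :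
    polarBlowDown N e c ∈ W ↔ c ∈ W := by
  have h1 := hNW (polarBlowDown_sub_mem he c)
  rw [← W.sub_mem_iff_left (y := c - polarBlowDown N e c) (x := c) (by
    rw [← neg_sub]; exact W.neg_mem h1), sub_sub_cancel]

theorem polarBlowDown_mem_iff_of_orthogonal_le (hNW : Nᗮ ≤ W) (hc : inner ℝ c e ≠ 0) :
    polarBlowDown N e c ∈ W ↔ polarSlope N e c ∈ W := by
  rw [polarBlowDown, W.add_mem_iff_right (hNW (N.sub_starProjection_mem_orthogonal c)),
    W.smul_mem_iff hc]

/-- With `polarBlowDown_mem_iff_of_orthogonal_le`: a subspace that contains the centre and the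
direction `e` is its own lift. -/
theorem polarSlope_mem_iff (hNW : Nᗮ ≤ W) (heW : e ∈ W) : polarSlope N e c ∈ W ↔ c ∈ W := by
  rw [polarSlope, W.add_mem_iff_left heW, W.sub_mem_iff_left (W.smul_mem _ heW)]
  have h := hNW (N.sub_starProjection_mem_orthogonal c)
  constructor
  · intro h1
    have := W.add_mem h h1
    rwa [sub_add_cancel] at this
  · intro h1
    have := W.sub_mem h1 h
    rwa [sub_sub_cancel] at this

end

/-! ### Local models of the stages of the iterated blow-up -/

namespace BlowUpStage

variable {k : ℕ}

/-- A chart `Φ` near the point `z` of a stage of the blow-up in which everything is linear.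
The index sets in `done` have been blown up; `B` consists of those whose face contains `z`, and `A`
of those, not yet blown up, whose diagonal contains `z`.  The diagonals are diagonal subspaces and
the faces are hyperplanes bounding half spaces, whose unit normal vectors `e K` are the directions
in which the clusters `K` come apart.  The fields `union_mem` and `ssubset_or_disjoint` control the
relative position of the remaining index sets, and are what makes `nested` persist under the next
blow-up. -/
structure IsLocalModel (S : BlowUpStage.{u} k) (done : Set (Finset (Fin k)))
    (z : S.space.Carrier) (A B : Set (Finset (Fin k))) (e : Finset (Fin k) → ConfigVec k)
    (O : Set S.space.Carrier) (Φ : S.space.Carrier → ConfigVec k) : Prop where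
  chart : S.space.IsChart {c | ∀ K ∈ B, 0 ≤ inner ℝ c (e K)} O Φ
  mem : z ∈ O
  center : Φ z = 0
  notMem_done : ∀ J ∈ A, J ∉ done
  subset_done : B ⊆ done
  normal_mem : ∀ K ∈ B, e K ∈ (diagSubspace K)ᗮ
  norm_normal : ∀ K ∈ B, ‖e K‖ = 1
  normal_mem_diag : ∀ K ∈ B, ∀ J ∈ A, e K ∈ diagSubspace J
  union_mem : ∀ I ∈ A, ∀ J ∈ A, (I ∩ J).Nonempty → I ∪ J ∈ A
  ssubset_or_disjoint : ∀ J ∈ A, ∀ K ∈ B, J ⊂ K ∨ Disjoint J K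
  nested : ∀ I ∈ B, ∀ J ∈ B, I ⊆ J ∨ J ⊆ I ∨ Disjoint I J
  mem_face_iff : ∀ K ∈ B, ∀ x ∈ O, x ∈ S.face K ↔ inner ℝ (Φ x) (e K) = 0
  notMem_face : ∀ K ∉ B, z ∉ S.face K
  mem_diagonal_iff : ∀ J ∈ A, ∀ x ∈ O, x ∈ S.diagonal J ↔ Φ x ∈ diagSubspace J
  notMem_diagonal : ∀ J ∉ done, 2 ≤ J.card → J ∉ A → z ∉ S.diagonal J

/-- All points of the stage have linear models. -/
structure IsLocallyLinear (S : BlowUpStage.{u} k) (done : Set (Finset (Fin k))) : Prop where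
  hasCharts : S.space.HasCharts (ConfigVec k)
  isClosed_diagonal : ∀ J, IsClosed (S.diagonal J)
  isClosed_face : ∀ K, IsClosed (S.face K)
  exists_model : ∀ z, ∃ A B e O Φ, S.IsLocalModel done z A B e O Φ

variable {S : BlowUpStage.{u} k} {done : Set (Finset (Fin k))} {z : S.space.Carrier}
  {A B : Set (Finset (Fin k))} {e : Finset (Fin k) → ConfigVec k}
  {O : Set S.space.Carrier} {Φ : S.space.Carrier → ConfigVec k} {I : Finset (Fin k)}

/-- The blow-down map of a step. -/
def stepDown (S : BlowUpStage.{u} k) (I : Finset (Fin k)) :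
    (S.step I).space.Carrier → S.space.Carrier := S.space.blowDown (S.diagonal I)

theorem step_face_self : (S.step I).face I = S.stepDown I ⁻¹' S.diagonal I := if_pos rfl

theorem step_face_of_ne {K : Finset (Fin k)} (h : K ≠ I) :
    (S.step I).face K = S.space.lift (S.diagonal I) (S.face K) := if_neg h

theorem step_diagonal (J : Finset (Fin k)) :
    (S.step I).diagonal J = S.space.lift (S.diagonal I) (S.diagonal J) := rfl

namespace IsLocalModel

/-- Away from the centre, nothing changes. -/
theorem step_of_notMem (h : S.IsLocalModel done z A B e O Φ) (hS : S.IsLocallyLinear done)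
    (hI : I ∉ A) (hcard : 2 ≤ I.card) (hdone : I ∉ done) {q : (S.step I).space.Carrier}
    (hq : S.stepDown I q = z) :
    (S.step I).IsLocalModel (insert I done) q A B e (S.stepDown I ⁻¹' (O ∩ (S.diagonal I)ᶜ))
      (Φ ∘ S.stepDown I) := by
  have hz : z ∉ S.diagonal I := h.notMem_diagonal I hdone hcard hI
  have hne : ∀ K ∈ B, K ≠ I := fun K hK hKI => hdone (hKI ▸ h.subset_done hK)
  exact
  { chart := (h.chart.mono (h.chart.isOpen.inter (hS.isClosed_diagonal I).isOpen_compl)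
      inter_subset_left).comp_blowDown hS.hasCharts (hS.isClosed_diagonal I) fun x hx => hx.2
    mem := by
      rw [mem_preimage, hq]
      exact ⟨h.mem, hz⟩
    center := by rw [Function.comp_apply, hq, h.center]
    notMem_done := fun J hJ hJ' => by
      rcases hJ' with rfl | hJ'
      · exact hI hJ
      · exact h.notMem_done J hJ hJ'
    subset_done := h.subset_done.trans (subset_insert _ _)
    normal_mem := h.normal_mem
    norm_normal := h.norm_normal
    normal_mem_diag := h.normal_mem_diag
    union_mem := h.union_mem
    ssubset_or_disjoint := h.ssubset_or_disjoint
    nested := h.nested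
    mem_face_iff := fun K hK x hx => by
      rw [step_face_of_ne (hne K hK)]
      refine (SmoothSpace.mem_lift_iff_of_notMem (hS.isClosed_face K) hx.2).trans ?_
      exact h.mem_face_iff K hK _ hx.1
    notMem_face := fun K hK hqK => by
      by_cases hKI : K = I
      · rw [hKI, step_face_self, mem_preimage, hq] at hqK
        exact hz hqK
      · rw [step_face_of_ne hKI] at hqK
        have := SmoothSpace.lift_subset (hS.isClosed_face K) hqK
        exact h.notMem_face K hK (hq ▸ this)
    mem_diagonal_iff := fun J hJ x hx => by
      refine (SmoothSpace.mem_lift_iff_of_notMem (hS.isClosed_diagonal J) hx.2).trans ?_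
      exact h.mem_diagonal_iff J hJ _ hx.1
    notMem_diagonal := fun J hJ hJ2 hJA hqJ => by
      have := SmoothSpace.lift_subset (hS.isClosed_diagonal J) hqJ
      exact h.notMem_diagonal J (fun h' => hJ (mem_insert_of_mem _ h')) hJ2 hJA (hq ▸ this) }

/-- The domain of a local model is invariant under translation along the normal space of each
remaining diagonal: the diagonal meets all faces transversally. -/
theorem add_mem_of_mem (h : S.IsLocalModel done z A B e O Φ) (hI : I ∈ A) :
    ∀ c ∈ {c : ConfigVec k | ∀ K ∈ B, 0 ≤ inner ℝ c (e K)}, ∀ n ∈ (diagSubspace I)ᗮ,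
      c + n ∈ {c : ConfigVec k | ∀ K ∈ B, 0 ≤ inner ℝ c (e K)} := by
  intro c hc n hn K hK
  have h0 : inner ℝ n (e K) = 0 :=
    (Submodule.mem_orthogonal' _ _).1 hn _ (h.normal_mem_diag K hK I hI)
  rw [inner_add_left, h0, add_zero]
  exact hc K hK

theorem mem_diagonal_iff_orthogonal (h : S.IsLocalModel done z A B e O Φ) (hI : I ∈ A) :
    ∀ x ∈ O, x ∈ S.diagonal I ↔ Φ x ∈ (diagSubspace I)ᗮᗮ := by
  rw [Submodule.orthogonal_orthogonal]
  exact h.mem_diagonal_iff I hI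

/-- An index set that can still be blown up at `z` is contained in or disjoint from the one that
is blown up next: otherwise their union would still have to be blown up. -/
theorem subset_or_disjoint_of_maximal (h : S.IsLocalModel done z A B e O Φ) (hI : I ∈ A)
    (hmax : ∀ J, I ⊂ J → J ∈ done) {J : Finset (Fin k)} (hJ : J ∈ A) : J ⊆ I ∨ Disjoint J I := by
  by_cases hne : (J ∩ I).Nonempty
  · left
    by_contra hJI
    have h1 := h.union_mem J hJ I hI hne
    refine h.notMem_done _ h1 (hmax _ ⟨Finset.subset_union_right, fun h2 => hJI ?_⟩)
    exact Finset.subset_union_left.trans h2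
  · right
    rwa [Finset.not_nonempty_iff_eq_empty, ← Finset.disjoint_iff_inter_eq_empty] at hne

open Classical in
/-- On the front face, the polar vector becomes a new normal vector, and those diagonals survive
that contain it. -/
theorem step_of_mem (h : S.IsLocalModel done z A B e O Φ) (hS : S.IsLocallyLinear done)
    (hI : I ∈ A) (hmax : ∀ J, I ⊂ J → J ∈ done) {n : ℕ}
    {b : OrthonormalBasis (Fin n) ℝ (ConfigVec k)} {g : Fin n → S.space.ideal (S.diagonal I)}
    {O' : Set S.space.Carrier} (hO' : O' ⊆ O)
    (hg : S.space.IsAdaptedChart (S.diagonal I) {c | ∀ K ∈ B, 0 ≤ inner ℝ c (e K)} O' Φ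
      (diagSubspace I)ᗮ b g) {q : (S.step I).space.Carrier} (hq : S.stepDown I q = z)
    (hz : z ∈ O') {v : ConfigVec k}
    (hv : SmoothSpace.polarVector b g (SmoothSpace.direction q) = v) :
    (S.step I).IsLocalModel (insert I done) q {J ∈ A | J ≠ I ∧ v ∈ diagSubspace J} (insert I B)
      (Function.update e I v) (SmoothSpace.blowUpDomain O' b g v)
      (SmoothSpace.blowUpCoord Φ (diagSubspace I)ᗮ b g v) := by
  have hqO : S.space.blowDown (S.diagonal I) q ∈ O' := by rw [← hq] at hz; exact hz
  have hvN : v ∈ (diagSubspace I)ᗮ := hv ▸ hg.polarVector_mem hqO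
  have hv1 : ‖v‖ = 1 := hv ▸ hg.norm_polarVector hqO
  have hIdone : I ∉ done := h.notMem_done I hI
  have hne : ∀ K ∈ B, K ≠ I := fun K hK hKI => hIdone (hKI ▸ h.subset_done hK)
  have hupd : ∀ K ∈ B, Function.update e I v K = e K := fun K hK =>
    Function.update_of_ne (hne K hK) _ _
  have hvdisj : ∀ J, Disjoint J I → v ∈ diagSubspace J := fun J hJ =>
    orthogonal_diagSubspace_le hJ hvN
  have hortho : ∀ J, J ⊆ I → (diagSubspace I)ᗮᗮ ≤ diagSubspace J := fun J hJ => by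
    rw [Submodule.orthogonal_orthogonal]
    exact diagSubspace_anti hJ
  have hclosed : ∀ J : Finset (Fin k), IsClosed (diagSubspace J : Set (ConfigVec k)) := fun J =>
    (diagSubspace J).closed_of_finiteDimensional
  have hcenter : SmoothSpace.blowUpCoord Φ (diagSubspace I)ᗮ b g v q = 0 := by
    have h1 : Φ (S.space.blowDown (S.diagonal I) q) = 0 := by
      rw [← h.center, ← hq]; rfl
    show polarChart _ v (Φ (S.space.blowDown (S.diagonal I) q))
      (SmoothSpace.polarVector b g (SmoothSpace.direction q)) = 0
    rw [h1, hv, polarChart, real_inner_self_eq_norm_sq, hv1]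
    simp
  have hmem : q ∈ SmoothSpace.blowUpDomain O' b g v := by
    refine ⟨hqO, ?_⟩
    rw [hv, real_inner_self_eq_norm_sq, hv1]
    norm_num
  have hset : {c : ConfigVec k | ∀ K ∈ insert I B, 0 ≤ inner ℝ c (Function.update e I v K)} =
      {c | ∀ K ∈ B, 0 ≤ inner ℝ c (e K)} ∩ {c | 0 ≤ inner ℝ c v} := by
    ext c
    constructor
    · intro hc
      refine ⟨fun K hK => ?_, ?_⟩
      · have := hc K (mem_insert_of_mem _ hK)
        rwa [hupd K hK] at this
      · have := hc I (mem_insert _ _)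
        rwa [Function.update_self] at this
    · rintro ⟨hc, hc'⟩ K hK
      rcases hK with rfl | hK
      · rw [Function.update_self]; exact hc'
      · rw [hupd K hK]; exact hc K hK
  have hclI := hS.isClosed_diagonal I
  exact
  { chart := by
      rw [hset]
      exact hg.isChart_blowUpCoord hS.hasCharts hclI hvN hv1
    mem := hmem
    center := hcenter
    notMem_done := fun J hJ hJ' => by
      rcases hJ' with rfl | hJ'
      · exact hJ.2.1 rfl
      · exact h.notMem_done J hJ.1 hJ'
    subset_done := insert_subset_insert h.subset_done
    normal_mem := fun K hK => by
      rcases hK with rfl | hK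
      · rwa [Function.update_self]
      · rw [hupd K hK]; exact h.normal_mem K hK
    norm_normal := fun K hK => by
      rcases hK with rfl | hK
      · rwa [Function.update_self]
      · rw [hupd K hK]; exact h.norm_normal K hK
    normal_mem_diag := fun K hK J hJ => by
      rcases hK with rfl | hK
      · rw [Function.update_self]; exact hJ.2.2
      · rw [hupd K hK]; exact h.normal_mem_diag K hK J hJ.1
    union_mem := fun J hJ J' hJ' hJJ' => by
      refine ⟨h.union_mem J hJ.1 J' hJ'.1 hJJ', fun hU => ?_,
        diagSubspace_union hJ.2.2 hJ'.2.2 hJJ'⟩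
      -- a nonzero normal vector of the diagonal of `I` cannot lie in that diagonal
      have h1 : v ∈ diagSubspace I := hU ▸ diagSubspace_union hJ.2.2 hJ'.2.2 hJJ'
      have h2 : inner ℝ v v = 0 := (Submodule.mem_orthogonal' _ _).1 hvN _ h1
      rw [real_inner_self_eq_norm_sq, hv1] at h2
      norm_num at h2
    ssubset_or_disjoint := fun J hJ K hK => by
      rcases hK with rfl | hK
      · exact (h.subset_or_disjoint_of_maximal hI hmax hJ.1).imp_left
          fun h1 => Finset.ssubset_iff_subset_ne.2 ⟨h1, hJ.2.1⟩
      · exact h.ssubset_or_disjoint J hJ.1 K hK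
    nested := fun K hK K' hK' => by
      rcases hK with rfl | hK <;> rcases hK' with rfl | hK'
      · exact Or.inl subset_rfl
      · exact (h.ssubset_or_disjoint _ hI K' hK').imp (fun h1 => h1.1) Or.inr
      · rcases h.ssubset_or_disjoint _ hI K hK with h1 | h1
        · exact Or.inr (Or.inl h1.1)
        · exact Or.inr (Or.inr h1.symm)
      · exact h.nested K hK K' hK'
    mem_face_iff := fun K hK x hx => by
      rcases hK with rfl | hK
      · rw [step_face_self, Function.update_self, mem_preimage]
        show S.space.blowDown _ x ∈ _ ↔ _
        rw [hg.mem_iff _ hx.1, ← hg.polarBlowDown_blowUpCoord hvN hv1 hx,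
          polarBlowDown_mem_orthogonal_iff hvN hv1]
      · rw [step_face_of_ne (hne K hK), hupd K hK]
        have hz0 : ∀ w ∈ (diagSubspace I)ᗮ, inner ℝ w (e K) = 0 := fun w hw =>
          (Submodule.mem_orthogonal' _ _).1 hw _ (h.normal_mem_diag K hK I hI)
        refine hg.mem_lift_iff hS.hasCharts hclI hvN hv1 hx
          (W₀ := {c | inner ℝ c (e K) = 0}) (W₁ := {c | inner ℝ c (e K) = 0})
          (fun y hy => h.mem_face_iff K hK y (hO' hy))
          (isClosed_eq (continuous_id.inner continuous_const) continuous_const)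
          (fun c hc ε _ => ?_) (.of_forall fun c _ => ?_)
        · show inner ℝ _ _ = 0
          have hc' : inner ℝ c (e K) = 0 := hc
          rw [inner_add_left, hc', real_inner_smul_left, hz0 v hvN, mul_zero, add_zero]
        · show inner ℝ _ _ = 0 ↔ inner ℝ c (e K) = 0
          have h1 := hz0 _ (polarBlowDown_sub_mem hvN c)
          rw [inner_sub_left, sub_eq_zero] at h1
          rw [h1]
    notMem_face := fun K hK hqK => by
      have hKI : K ≠ I := fun h1 => hK (h1 ▸ mem_insert _ _)
      rw [step_face_of_ne hKI] at hqK
      have := SmoothSpace.lift_subset (hS.isClosed_face K) hqK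
      exact h.notMem_face K (fun h1 => hK (mem_insert_of_mem _ h1)) (hq ▸ this)
    mem_diagonal_iff := fun J hJ x hx => by
      rw [step_diagonal]
      refine hg.mem_lift_iff hS.hasCharts hclI hvN hv1 hx
        (W₀ := diagSubspace J) (W₁ := diagSubspace J)
        (fun y hy => h.mem_diagonal_iff J hJ.1 y (hO' hy)) (hclosed J)
        (fun c hc ε _ => (diagSubspace J).add_mem hc ((diagSubspace J).smul_mem _ hJ.2.2))
        (.of_forall fun c hc => ?_)
      rw [SetLike.mem_coe, SetLike.mem_coe]
      rcases h.subset_or_disjoint_of_maximal hI hmax hJ.1 with h1 | h1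
      · rw [polarBlowDown_mem_iff_of_orthogonal_le (hortho J h1) hc.ne',
          polarSlope_mem_iff (hortho J h1) hJ.2.2]
      · exact polarBlowDown_mem_iff_of_le hvN (orthogonal_diagSubspace_le h1)
    notMem_diagonal := fun J hJ hJ2 hJA hqJ => by
      have hJI : J ≠ I := fun h1 => hJ (h1 ▸ mem_insert _ _)
      by_cases hJA' : J ∈ A
      · have hvJ : v ∉ diagSubspace J := fun h1 => hJA ⟨hJA', hJI, h1⟩
        have hsub : J ⊆ I := (h.subset_or_disjoint_of_maximal hI hmax hJA').resolve_right
          fun h1 => hvJ (hvdisj J h1)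
        rw [step_diagonal] at hqJ
        -- near `q` the slope is near `v`, which is not in the diagonal, so that off the front face
        -- the lift is empty
        refine (hg.mem_lift_iff hS.hasCharts hclI hvN hv1 hmem (W₀ := diagSubspace J)
          (W₁ := ∅) (fun y hy => h.mem_diagonal_iff J hJA' y (hO' hy)) isClosed_empty
          (fun c hc => hc.elim) ?_).1 hqJ
        refine nhdsWithin_le_nhds ?_
        have hslope : polarSlope (diagSubspace I)ᗮ v
            (SmoothSpace.blowUpCoord Φ (diagSubspace I)ᗮ b g v q) = v := by
          rw [hcenter, polarSlope]; simp
        have hev := (contDiff_polarSlope (N := (diagSubspace I)ᗮ) (e := v)).continuous.continuousAt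
          (x := SmoothSpace.blowUpCoord Φ (diagSubspace I)ᗮ b g v q)
          ((hclosed J).isOpen_compl.mem_nhds (by rw [hslope]; exact hvJ))
        filter_upwards [hev] with c hc hc0
        rw [SetLike.mem_coe, polarBlowDown_mem_iff_of_orthogonal_le (hortho J hsub) hc0.ne']
        exact iff_of_false hc id
      · have := SmoothSpace.lift_subset (hS.isClosed_diagonal J) hqJ
        exact h.notMem_diagonal J (fun h' => hJ (mem_insert_of_mem _ h')) hJ2 hJA' (hq ▸ this) }

end IsLocalModel

end BlowUpStage

/-! ### Induction over the blow-ups -/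

namespace BlowUpStage

variable {k : ℕ} {S : BlowUpStage.{u} k} {done : Set (Finset (Fin k))} {z : S.space.Carrier}
  {A B : Set (Finset (Fin k))} {e : Finset (Fin k) → ConfigVec k}
  {O : Set S.space.Carrier} {Φ : S.space.Carrier → ConfigVec k} {I : Finset (Fin k)}

open Classical in
/-- When the diagonal of `I` is blown up, every unit vector normal to it is the polar vector of a
point over `z`. -/
theorem IsLocalModel.exists_step_of_mem (h : S.IsLocalModel done z A B e O Φ)
    (hS : S.IsLocallyLinear done) (hI : I ∈ A) (hmax : ∀ J, I ⊂ J → J ∈ done) {v : ConfigVec k}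
    (hv : v ∈ (diagSubspace I)ᗮ) (hv1 : ‖v‖ = 1) :
    ∃ (q : (S.step I).space.Carrier) (O' : Set (S.step I).space.Carrier)
      (Φ' : (S.step I).space.Carrier → ConfigVec k),
      (S.step I).IsLocalModel (insert I done) q {J ∈ A | J ≠ I ∧ v ∈ diagSubspace J} (insert I B)
        (Function.update e I v) O' Φ' := by
  obtain ⟨O', hO', hz, g, hg⟩ := h.chart.exists_isAdaptedChart hS.hasCharts (h.add_mem_of_mem hI)
    (h.mem_diagonal_iff_orthogonal hI) (stdOrthonormalBasis ℝ (ConfigVec k)) h.mem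
  obtain ⟨q, hq, hqv⟩ := hg.exists_blowUp_point hS.hasCharts (hS.isClosed_diagonal I) hz hv hv1
    (by rw [h.center]; simp)
  exact ⟨q, _, _, h.step_of_mem hS hI hmax hO' hg hq hz hqv⟩

/-- A point outside the centre has a point of the blow-up over it, with the same local model. -/
theorem IsLocalModel.exists_step_of_notMem (h : S.IsLocalModel done z A B e O Φ)
    (hS : S.IsLocallyLinear done) (hI : I ∉ A) (hcard : 2 ≤ I.card) (hdone : I ∉ done) :
    ∃ (q : (S.step I).space.Carrier) (O' : Set (S.step I).space.Carrier)
      (Φ' : (S.step I).space.Carrier → ConfigVec k),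
      (S.step I).IsLocalModel (insert I done) q A B e O' Φ' :=
  ⟨SmoothSpace.graphPoint ((hS.hasCharts.evalAt_ne_zero_iff (hS.isClosed_diagonal I)).2
    (h.notMem_diagonal I hdone hcard hI)), _, _, h.step_of_notMem hS hI hcard hdone rfl⟩

/-- Blowing up the largest remaining diagonal preserves local linearity. -/
theorem IsLocallyLinear.step (hS : S.IsLocallyLinear done) (hcard : 2 ≤ I.card) (hdone : I ∉ done)
    (hmax : ∀ J, I ⊂ J → J ∈ done) : (S.step I).IsLocallyLinear (insert I done) where
  hasCharts := by
    refine hS.hasCharts.blowUp (hS.isClosed_diagonal I) fun y hy => ?_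
    obtain ⟨A, B, e, O, Φ, h⟩ := hS.exists_model y
    have hI : I ∈ A := by
      by_contra hI
      exact h.notMem_diagonal I hdone hcard hI hy
    exact ⟨_, O, Φ, _, h.mem, h.chart, h.add_mem_of_mem hI, h.mem_diagonal_iff_orthogonal hI⟩
  isClosed_diagonal J := SmoothSpace.isClosed_lift _
  isClosed_face K := by
    by_cases hK : K = I
    · rw [hK, step_face_self]
      exact (hS.isClosed_diagonal I).preimage SmoothSpace.continuous_blowDown
    · rw [step_face_of_ne hK]
      exact SmoothSpace.isClosed_lift _
  exists_model q := by
    classical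
    obtain ⟨A, B, e, O, Φ, h⟩ := hS.exists_model (S.stepDown I q)
    by_cases hI : I ∈ A
    · obtain ⟨O', hO', hz, g, hg⟩ := h.chart.exists_isAdaptedChart hS.hasCharts
        (h.add_mem_of_mem hI) (h.mem_diagonal_iff_orthogonal hI)
        (stdOrthonormalBasis ℝ (ConfigVec k)) h.mem
      exact ⟨_, _, _, _, _, h.step_of_mem hS hI hmax hO' hg rfl hz rfl⟩
    · exact ⟨_, _, _, _, _, h.step_of_notMem hS hI hcard hdone rfl⟩

section Initial

/-- Points that coincide at `p` are compared in the same chart of `M`, so the diagonals through `p`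
are linear in the coordinates centred at `p`. -/
theorem mem_partialDiagonal_iff_configCoord {M : Type u} [TopologicalSpace M]
    [ChartedSpace ℂ M] {p x : Fin k → M} {J : Finset (Fin k)}
    (hJ : p ∈ partialDiagonal M k J)
    (hx : x ∈ (chartAt (ModelPi fun _ : Fin k => ℂ) p).source) :
    x ∈ partialDiagonal M k J ↔ configCoord p x ∈ diagSubspace J := by
  have hx' : ∀ i, x i ∈ (chartAt ℂ (p i)).source := (mem_source_iff p x).1 hx
  refine forall₄_congr fun i hi j hj => ?_
  have hij : p i = p j := hJ i hi j hj
  rw [configCoord_apply, configCoord_apply, ← hij, sub_left_inj]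
  exact ((chartAt ℂ (p i)).injOn.eq_iff (hx' i) (by rw [hij]; exact hx' j)).symm

variable {M : Type u} [TopologicalSpace M] [T2Space M] [ChartedSpace ℂ M]
  [IsManifold 𝓘(ℂ, ℂ) ω M]

theorem isLocalModel_initial (p : Fin k → M) (e : Finset (Fin k) → ConfigVec k) :
    (initial M k).IsLocalModel ∅ p {J | p ∈ partialDiagonal M k J} ∅ e
      (chartAt (ModelPi fun _ : Fin k => ℂ) p).source (configCoord p) where
  chart := by
    have : {c : ConfigVec k | ∀ K ∈ (∅ : Set (Finset (Fin k))), 0 ≤ inner ℝ c (e K)} = univ :=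
      eq_univ_of_forall fun c K hK => hK.elim
    rw [this]
    exact isChart_configCoord p
  mem := mem_chart_source (ModelPi fun _ : Fin k => ℂ) p
  center := configCoord_self p
  notMem_done _ _ h := h
  subset_done := subset_rfl
  normal_mem _ h := h.elim
  norm_normal _ h := h.elim
  normal_mem_diag _ h := h.elim
  union_mem I hI J hJ hIJ := by
    obtain ⟨m, hm⟩ := hIJ
    rw [Finset.mem_inter] at hm
    have : ∀ i ∈ I ∪ J, p i = p m := fun i hi => by
      rcases Finset.mem_union.1 hi with h | h
      · exact hI i h m hm.1
      · exact hJ i h m hm.2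
    exact fun i hi j hj => (this i hi).trans (this j hj).symm
  ssubset_or_disjoint _ _ _ h := h.elim
  nested _ h := h.elim
  mem_face_iff _ h := h.elim
  notMem_face _ _ h := h
  mem_diagonal_iff _ hJ _ hx := mem_partialDiagonal_iff_configCoord hJ hx
  notMem_diagonal _ _ _ h := h

theorem isLocallyLinear_initial : (initial M k).IsLocallyLinear ∅ where
  hasCharts := hasCharts_configSpace k
  isClosed_diagonal J := by
    have : partialDiagonal M k J = ⋂ i ∈ J, ⋂ j ∈ J, {p : Fin k → M | p i = p j} := by
      ext p; simp [partialDiagonal]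
    show IsClosed (partialDiagonal M k J)
    rw [this]
    exact isClosed_biInter fun i _ => isClosed_biInter fun j _ =>
      isClosed_eq (continuous_apply i) (continuous_apply j)
  isClosed_face _ := isClosed_empty
  exists_model p := ⟨_, _, 0, _, _, isLocalModel_initial p 0⟩

end Initial

/-- Induction along an admissible order of blow-up.  At each step the set of the index sets already
blown up is closed under passage to larger sets, and contains all sets larger than the next one. -/
theorem foldl_step_induction {L : List (Finset (Fin k))} (hL : IsBlowUpOrder L)
    {Q : BlowUpStage.{u} k → Set (Finset (Fin k)) → Prop} {S₀ : BlowUpStage.{u} k} (h0 : Q S₀ ∅)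
    (hstep : ∀ (S : BlowUpStage.{u} k) (done : Set (Finset (Fin k))) (I : Finset (Fin k)),
      Q S done → 2 ≤ I.card → I ∉ done → (∀ J, I ⊂ J → J ∈ done) →
      (∀ K ∈ done, ∀ J, K ⊂ J → J ∈ done) → Q (S.step I) (insert I done)) :
    Q (L.foldl step S₀) {J | 2 ≤ J.card} := by
  obtain ⟨hnd, hmem, hord⟩ := hL
  have key : ∀ (R D : List (Finset (Fin k))) (S : BlowUpStage.{u} k), L = D ++ R →
      Q S {J | J ∈ D} → Q (R.foldl step S) {J | J ∈ L} := by
    intro R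
    induction R with
    | nil =>
      intro D S hLD hQ
      rw [List.append_nil] at hLD
      rw [hLD]
      exact hQ
    | cons I R ih =>
      intro D S hLD hQ
      have hup : ∀ K, K ∈ D ++ [I] → ∀ J, K ⊂ J → J ∈ D := by
        intro K hK J hKJ
        have hK2 : 2 ≤ K.card := (hmem K).1 (by
          rw [hLD, ← List.singleton_append, ← List.append_assoc]
          exact List.mem_append_left _ hK)
        have hJ : J ∈ D ++ I :: R := hLD ▸ (hmem J).2 (hK2.trans (Finset.card_le_card hKJ.1))
        rw [hLD, List.pairwise_append, List.pairwise_cons] at hord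
        rcases List.mem_append.1 hJ with h1 | h1
        · exact h1
        rcases List.mem_append.1 hK with h2 | h2
        · exact absurd hKJ (hord.2.2 K h2 J h1)
        · rw [List.mem_singleton] at h2
          subst h2
          rcases List.mem_cons.1 h1 with h3 | h3
          · exact absurd (h3 ▸ hKJ) (ssubset_irrefl _)
          · exact absurd hKJ (hord.2.1.1 J h3)
      have hI : I ∉ D := by
        rw [hLD, List.nodup_append] at hnd
        exact fun h => hnd.2.2 I h I (by simp) rfl
      refine ih (D ++ [I]) (S.step I) (by rw [hLD]; simp) ?_
      have hins : {J | J ∈ D ++ [I]} = insert I {J | J ∈ D} := by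
        ext J; simp [or_comm]
      rw [hins]
      exact hstep S _ I hQ ((hmem I).1 (by rw [hLD]; simp)) hI
        (fun J hJ => hup I (by simp) J hJ)
        (fun K hK J hJ => hup K (List.mem_append_left _ hK) J hJ)
  have h1 := key L [] S₀ rfl (by simpa using h0)
  have h2 : {J : Finset (Fin k) | J ∈ L} = {J | 2 ≤ J.card} := by
    ext J; exact hmem J
  rwa [h2] at h1

end BlowUpStage

/-! ### Trees of clusters -/

namespace IsClusterTree

variable {k : ℕ} {T : Set (Finset (Fin k))}

theorem two_le_card_of_mem (hT : IsClusterTree T) {I : Finset (Fin k)} (hI : I ∈ T) :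
    2 ≤ I.card := by
  obtain ⟨J, hJI, hJ⟩ := (toFinite T).exists_le_minimal hI
  exact (hT.two_le_card J hJ).trans (Finset.card_le_card hJI)

theorem subset_or_subset (hT : IsClusterTree T) {I J : Finset (Fin k)} (hI : I ∈ T) (hJ : J ∈ T)
    {i : Fin k} (hiI : i ∈ I) (hiJ : i ∈ J) : I ⊆ J ∨ J ⊆ I :=
  hT.branch I hI J hJ {i} (Finset.singleton_nonempty i) (Finset.singleton_subset_iff.2 hiI)
    (Finset.singleton_subset_iff.2 hiJ)

/-- For a vertex `K` of a tree there is a configuration of the cluster `K` in which two points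
coincide exactly if they lie in a common smaller vertex. -/
theorem exists_normal (hT : IsClusterTree T) {K : Finset (Fin k)} (hK : K ∈ T) :
    ∃ v : ConfigVec k, v ∈ (diagSubspace K)ᗮ ∧ ‖v‖ = 1 ∧ ∀ J ⊆ K, 2 ≤ J.card →
      (v ∈ diagSubspace J ↔ ∃ K' ∈ T, K' ⊂ K ∧ J ⊆ K') := by
  classical
  -- the class of `i` is the largest smaller vertex that contains it, or else just `i`
  let cls : Fin k → Finset (Fin k) := fun i =>
    Finset.univ.filter fun j => j = i ∨ ∃ K' ∈ T, K' ⊂ K ∧ i ∈ K' ∧ j ∈ K'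
  have hcls : ∀ i j, j ∈ cls i ↔ j = i ∨ ∃ K' ∈ T, K' ⊂ K ∧ i ∈ K' ∧ j ∈ K' := fun i j => by
    simp [cls]
  have hsub : ∀ K' ∈ T, K' ⊂ K → ∀ i ∈ K', ∀ j ∈ K', cls i ⊆ cls j := by
    intro K' hK' hK'K i hi j hj l hl
    rw [hcls] at hl ⊢
    rcases hl with rfl | ⟨K'', hK'', hK''K, hi'', hl⟩
    · exact Or.inr ⟨K', hK', hK'K, hj, hi⟩
    · rcases hT.subset_or_subset hK' hK'' hi hi'' with h | h
      · exact Or.inr ⟨K'', hK'', hK''K, h hj, hl⟩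
      · exact Or.inr ⟨K', hK', hK'K, hj, h hl⟩
  -- place equivalent points at the same integer, inequivalent ones at different integers
  let w : ConfigVec k := WithLp.toLp 2 fun i => ((Encodable.encode (cls i) : ℕ) : ℂ)
  have hw : ∀ J : Finset (Fin k), w ∈ diagSubspace J ↔ ∀ i ∈ J, ∀ j ∈ J, cls i = cls j := by
    intro J
    refine forall₄_congr fun i _ j _ => ?_
    show ((Encodable.encode (cls i) : ℕ) : ℂ) = ((Encodable.encode (cls j) : ℕ) : ℂ) ↔ _
    rw [Nat.cast_inj, Encodable.encode_inj]
  have hwJ : ∀ J ⊆ K, 2 ≤ J.card → (w ∈ diagSubspace J ↔ ∃ K' ∈ T, K' ⊂ K ∧ J ⊆ K') := by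
    intro J hJK hJ
    rw [hw]
    constructor
    · intro h
      obtain ⟨i, hi, j, hj, hij⟩ := Finset.one_lt_card.1 hJ
      have hmem : ∀ l ∈ J, l = i ∨ ∃ K' ∈ T, K' ⊂ K ∧ i ∈ K' ∧ l ∈ K' := fun l hl => by
        rw [← hcls, h i hi l hl, hcls]
        exact Or.inl rfl
      -- the smaller vertices that contain `i` form a chain
      obtain ⟨K₁, hK₁, hK₁K, hiK₁, -⟩ := (hmem j hj).resolve_left (Ne.symm hij)
      obtain ⟨K₂, -, hK₂⟩ := (toFinite {K' | K' ∈ T ∧ K' ⊂ K ∧ i ∈ K'}).exists_le_maximal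
        ⟨hK₁, hK₁K, hiK₁⟩
      refine ⟨K₂, hK₂.prop.1, hK₂.prop.2.1, fun l hl => ?_⟩
      rcases hmem l hl with rfl | ⟨K', hK', hK'K, hiK', hlK'⟩
      · exact hK₂.prop.2.2
      · rcases hT.subset_or_subset hK' hK₂.prop.1 hiK' hK₂.prop.2.2 with h1 | h1
        · exact h1 hlK'
        · exact hK₂.le_of_ge ⟨hK', hK'K, hiK'⟩ h1 hlK'
    · rintro ⟨K', hK', hK'K, hJK'⟩ i hi j hj
      exact (hsub K' hK' hK'K i (hJK' hi) j (hJK' hj)).antisymm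
        (hsub K' hK' hK'K j (hJK' hj) i (hJK' hi))
  -- remove the component of `w` that does not separate points of `K`, then normalize
  set w' := w - (diagSubspace K).starProjection w with hw'
  have hw'mem : w' ∈ (diagSubspace K)ᗮ := (diagSubspace K).sub_starProjection_mem_orthogonal w
  have hne : w' ≠ 0 := by
    intro h0
    have h1 : w ∈ diagSubspace K := by
      rw [sub_eq_zero.1 h0]
      exact (diagSubspace K).starProjection_apply_mem w
    obtain ⟨K', -, h2, h3⟩ := (hwJ K subset_rfl (hT.two_le_card_of_mem hK)).1 h1
    exact h2.2 h3
  have hne' : ‖w'‖⁻¹ ≠ 0 := inv_ne_zero (norm_ne_zero_iff.2 hne)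
  refine ⟨‖w'‖⁻¹ • w', Submodule.smul_mem _ _ hw'mem, ?_, fun J hJK hJ => ?_⟩
  · rw [norm_smul, norm_inv, norm_norm, inv_mul_cancel₀ (norm_ne_zero_iff.2 hne)]
  rw [Submodule.smul_mem_iff _ hne', hw', Submodule.sub_mem_iff_left _
    (diagSubspace_anti hJK ((diagSubspace K).starProjection_apply_mem w))]
  exact hwJ J hJK hJ

end IsClusterTree

/-! ### Faces through a point, and corners -/

namespace BlowUpStage

variable {k : ℕ}

open Classical in
/-- Every tree of clusters is the set of faces through some point.  In each stage the point is
chosen on the faces of the vertices blown up so far and on precisely those remaining diagonals that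
contain their normal vectors; it starts in the small diagonal and moves in the direction `e K` when
the diagonal of a vertex `K` is blown up. -/
theorem exists_mem_face_iff {M : Type u} [TopologicalSpace M] [T2Space M] [ChartedSpace ℂ M]
    [IsManifold 𝓘(ℂ, ℂ) ω M] [Nonempty M] {L : List (Finset (Fin k))} (hL : IsBlowUpOrder L)
    {T : Set (Finset (Fin k))} (hT : IsClusterTree T) :
    ∃ z, ∀ K, z ∈ (extendedConfig M k L).face K ↔ K ∈ T := by
  choose! e he he1 heJ using fun K (hK : K ∈ T) => hT.exists_normal hK
  have key := foldl_step_induction hL (S₀ := initial M k)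
    (Q := fun S done => S.IsLocallyLinear done ∧ ∃ z A O Φ,
      S.IsLocalModel done z A (T ∩ done) e O Φ ∧
      ∀ J, 2 ≤ J.card → (J ∈ A ↔ J ∉ done ∧ ∀ K ∈ T ∩ done, e K ∈ diagSubspace J)) ?_ ?_
  · obtain ⟨-, z, A, O, Φ, h, -⟩ := key
    refine ⟨z, fun K => ⟨fun hz => ?_, fun hK => ?_⟩⟩
    · by_contra hK
      exact h.notMem_face K (fun h' => hK h'.1) hz
    · have := h.mem_face_iff K ⟨hK, hT.two_le_card_of_mem hK⟩ z h.mem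
      rw [h.center, inner_zero_left] at this
      exact this.2 rfl
  · have h0 := isLocalModel_initial (M := M) (fun _ : Fin k => Classical.arbitrary M) e
    refine ⟨isLocallyLinear_initial, _, _, _, _, by rw [inter_empty]; exact h0, ?_⟩
    · intro J _
      simp [partialDiagonal]
  · rintro S done I ⟨hS, z, A, O, Φ, h, hA⟩ hcard hdone hmax hup
    refine ⟨hS.step hcard hdone hmax, ?_⟩
    by_cases hIT : I ∈ T
    · -- the diagonal of a vertex contains the directions of all larger or disjoint vertices
      have hIA : I ∈ A := by
        refine (hA I hcard).2 ⟨hdone, fun K hK => ?_⟩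
        by_cases hdisj : Disjoint I K
        · exact orthogonal_diagSubspace_le hdisj (he K hK.1)
        · obtain ⟨i, hiI, hiK⟩ := Finset.not_disjoint_iff.1 hdisj
          have hne : I ≠ K := fun h' => hdone (h' ▸ hK.2)
          rcases hT.subset_or_subset hIT hK.1 hiI hiK with h1 | h1
          · exact (heJ K hK.1 I h1 hcard).2
              ⟨I, hIT, Finset.ssubset_iff_subset_ne.2 ⟨h1, hne⟩, subset_rfl⟩
          · exact absurd (hup K hK.2 I (Finset.ssubset_iff_subset_ne.2 ⟨h1, hne.symm⟩)) hdone
      obtain ⟨q, O', Φ', hq⟩ := h.exists_step_of_mem hS hIA hmax (he I hIT) (he1 I hIT)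
      rw [Function.update_eq_self, ← inter_insert_of_mem hIT] at hq
      refine ⟨q, _, O', Φ', hq, fun J hJ => ?_⟩
      rw [inter_insert_of_mem hIT]
      constructor
      · rintro ⟨h1, h2, h3⟩
        obtain ⟨h4, h5⟩ := (hA J hJ).1 h1
        refine ⟨fun h6 => h6.elim h2 h4, fun K hK => ?_⟩
        rcases hK with rfl | hK
        · exact h3
        · exact h5 K hK
      · rintro ⟨h1, h2⟩
        exact ⟨(hA J hJ).2 ⟨fun h3 => h1 (mem_insert_of_mem _ h3),
          fun K hK => h2 K (mem_insert_of_mem _ hK)⟩, fun h3 => h1 (h3 ▸ mem_insert _ _),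
          h2 I (mem_insert _ _)⟩
    · -- the smallest vertex containing `I` separates points of `I`
      obtain ⟨K, -, hK⟩ := (toFinite {K | K ∈ T ∧ I ⊆ K}).exists_le_minimal
        (⟨hT.root, Finset.subset_univ I⟩ : Finset.univ ∈ {K | K ∈ T ∧ I ⊆ K})
      have hIK : I ⊂ K := Finset.ssubset_iff_subset_ne.2
        ⟨hK.prop.2, fun h' => hIT (h' ▸ hK.prop.1)⟩
      have heK : e K ∉ diagSubspace I := by
        rw [heJ K hK.prop.1 I hIK.1 hcard]
        rintro ⟨K', h1, h2, h3⟩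
        exact h2.2 (hK.le_of_le ⟨h1, h3⟩ h2.1)
      have hIA : I ∉ A := fun h' =>
        heK (((hA I hcard).1 h').2 K ⟨hK.prop.1, hmax K hIK⟩)
      obtain ⟨q, O', Φ', hq⟩ := h.exists_step_of_notMem hS hIA hcard hdone
      rw [inter_insert_of_notMem hIT]
      refine ⟨q, A, O', Φ', hq, fun J hJ => ?_⟩
      rw [hA J hJ]
      refine ⟨fun ⟨h1, h2⟩ => ⟨fun h3 => ?_, h2⟩,
        fun ⟨h1, h2⟩ => ⟨fun h3 => h1 (mem_insert_of_mem _ h3), h2⟩⟩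
      rcases h3 with rfl | h3
      · exact hIA ((hA J hJ).2 ⟨h1, h2⟩)
      · exact h1 h3

/-- The faces through a point of the extended configuration space are pairwise nested or
disjoint. -/
theorem nested_of_mem_face {M : Type u} [TopologicalSpace M] [T2Space M] [ChartedSpace ℂ M]
    [IsManifold 𝓘(ℂ, ℂ) ω M] {L : List (Finset (Fin k))} (hL : IsBlowUpOrder L)
    {z : (extendedConfig M k L).space.Carrier} :
    (∀ K, z ∈ (extendedConfig M k L).face K → 2 ≤ K.card) ∧
    ∀ I J, z ∈ (extendedConfig M k L).face I → z ∈ (extendedConfig M k L).face J →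
      I ⊆ J ∨ J ⊆ I ∨ Disjoint I J := by
  have hE : (extendedConfig M k L).IsLocallyLinear {J | 2 ≤ J.card} :=
    foldl_step_induction hL isLocallyLinear_initial
      fun S done I hS hcard hdone hmax _ => hS.step hcard hdone hmax
  obtain ⟨A, B, e, O, Φ, h⟩ := hE.exists_model z
  have hB : ∀ K, z ∈ (extendedConfig M k L).face K → K ∈ B := fun K hK => by
    by_contra h'
    exact h.notMem_face K h' hK
  exact ⟨fun K hK => h.subset_done (hB K hK), fun I J hI hJ => h.nested I (hB I hI) J (hB J hJ)⟩

variable {E : BlowUpStage.{u} k} {Z : Set E.space.Carrier}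

/-- A corner is the intersection of the faces that contain it. -/
theorem IsCornerOfMax.eq_iInter (hZ : E.IsCornerOfMax Z) (hroot : Finset.univ ∈ E.tree Z) :
    Z = ⋂ I ∈ E.tree Z, E.face I := by
  refine (subset_iInter₂ fun I hI => hI.2).antisymm ?_
  obtain ⟨-, S, hS, hZS⟩ := hZ
  have hST : ∀ I ∈ S, I ∈ E.tree Z := fun I hI => ⟨hS I hI, by
    rw [hZS]; exact inter_subset_right.trans (iInter₂_subset I hI)⟩
  conv_rhs => rw [hZS]
  exact subset_inter (iInter₂_subset _ hroot)
    (subset_iInter₂ fun I hI => iInter₂_subset I (hST I hI))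

end BlowUpStage

theorem mainTheorem6 {M : Type u} [TopologicalSpace M] [T2Space M] [CompactSpace M]
    [ConnectedSpace M] [ChartedSpace ℂ M] [IsManifold 𝓘(ℂ, ℂ) ω M]
    (k : ℕ) (L : List (Finset (Fin k))) (hL : IsBlowUpOrder L) :
    Set.BijOn (extendedConfig M k L).tree
      {Z | (extendedConfig M k L).IsCornerOfMax Z} {T | IsClusterTree T} ∧
    ∀ T : Set (Finset (Fin k)), IsClusterTree T →
      (extendedConfig M k L).IsCornerOfMax (⋂ I ∈ T, (extendedConfig M k L).face I) ∧
      (extendedConfig M k L).tree (⋂ I ∈ T, (extendedConfig M k L).face I) = T := by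
  set E := extendedConfig M k L with hE
  have hroot : ∀ Z, E.IsCornerOfMax Z → Finset.univ ∈ E.tree Z := by
    rintro Z ⟨⟨z, hz⟩, S, -, hZS⟩
    have hsub : Z ⊆ E.face Finset.univ := by rw [hZS]; exact inter_subset_left
    exact ⟨(BlowUpStage.nested_of_mem_face hL).1 _ (hsub hz), hsub⟩
  have hinv : ∀ T : Set (Finset (Fin k)), IsClusterTree T →
      E.IsCornerOfMax (⋂ I ∈ T, E.face I) ∧ E.tree (⋂ I ∈ T, E.face I) = T := by
    intro T hT
    obtain ⟨z, hz⟩ := BlowUpStage.exists_mem_face_iff (M := M) hL hT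
    have hzT : z ∈ ⋂ I ∈ T, E.face I := mem_iInter₂.2 fun I hI => (hz I).2 hI
    refine ⟨⟨⟨z, hzT⟩, T, fun I hI => hT.two_le_card_of_mem hI, ?_⟩, ?_⟩
    · exact (inter_eq_right.2 (iInter₂_subset _ hT.root)).symm
    · ext I
      exact ⟨fun hI => (hz I).1 (hI.2 hzT),
        fun hI => ⟨hT.two_le_card_of_mem hI, iInter₂_subset I hI⟩⟩
  refine ⟨⟨?_, ?_, ?_⟩, hinv⟩
  · intro Z hZ
    obtain ⟨z, hz⟩ := hZ.1
    refine ⟨hroot Z hZ, fun I hI J hJ K hK hKI hKJ => ?_, fun I hI => hI.prop.1⟩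
    rcases (BlowUpStage.nested_of_mem_face hL).2 I J (hI.2 hz) (hJ.2 hz) with h | h | h
    · exact Or.inl h
    · exact Or.inr h
    · obtain ⟨i, hi⟩ := hK
      exact absurd (hKJ hi) (Finset.disjoint_left.1 h (hKI hi))
  · intro Z hZ Z' hZ' hZZ'
    rw [hZ.eq_iInter (hroot Z hZ), hZ'.eq_iInter (hroot Z' hZ'), hZZ']
  · intro T hT
    exact ⟨_, (hinv T hT).1, (hinv T hT).2⟩
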